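/- Let $A$ be an integer $r\times N$ matrix with columns $\mathbf a_1,\dots,\mathbf a_N$, whose integer kernel $L=\{l\in\mathbb Z^N: Al=0\}$ has rank $d=N-r$ and is contained in the hyperplane $\sum_i l_i=0$. Let $B$ be a Gale dual of $A$, i.e. an integer $d\times N$ matrix whose rows form a $\mathbb Z$-basis of $L$, with columns $\mathbf b_1,\dots,\mathbf b_N$. Let $\gamma_0\in\mathbb R^N$ be such that $\alpha=A\gamma_0$ is totally non-resonant: for any $r-1$ linearly independent columns of $A$, the closed convex cone they generate does not meet $\alpha+\mathbb Z^r$. A *cotriangle* is a set $I\subset\{1,\dots,N\}$ with $|I|=d$ and $(\mathbf b_i)_{i\in I}$ linearly independent; let $B_I$ be the matrix with columns $\mathbf b_i$, $i\in I$ (in increasing order), and $C_I$ the closed convex cone generated by the $\mathbf b_i$, $i\in I$. For $\rho\in\mathbb R^d$ not in the span of any $d-1$ of the $\mathbf b_i$, the set $\mathcal I_\rho$ of cotriangles $I$ with $\rho\in C_I$ is called a *cotriangulation*. The *chamber* of a cotriangulation $\mathcal I$ is $\bigcap_{I\in\mathcal I}C_I$, and a *wall* is a face of a chamber of codimension $1$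 in $\mathbb R^d$. Two cotriangulations $\mathcal I,\mathcal J$ are *adjacent* with common wall $W$ if $W$ is a wall of both their chambers. In that case let $\mathcal I_W$ be the set of $I\in\mathcal I$ such that $W$ is contained in a codimension-$1$ face of $C_I$, and define $\mathcal J_W$ likewise. For $\mu\in[0,1)^d$ (a row vector) put $\gamma^\mu=\gamma_0+\mu B$ and $\zeta^\mu=(e^{2\pi i\mu_1},\dots,e^{2\pi i\mu_d})$. Call $\mu$ a *solution point* if there is a cotriangle $I$ with $\gamma^\mu_i\in\mathbb Z$ for all $i\in I$; by total non-resonance this $I$ is unique, and it is denoted $I(\mu)$. For $\tau\in\mathbb Z^d$ let $$\omega(\tau,\mathbf z)=\frac{\mathbf z^\tau}{f_1(\mathbf z)\cdots f_N(\mathbf z)}\,\frac{dz_1}{z_1}\wedge\cdots\wedge\frac{dz_d}{z_d},\qquad f_j(\mathbf z)=e^{2\pi i\gamma_{0,j}}\mathbf z^{\mathbf b_j}-1 .$$ For a solution point $\mu$ with $I=I(\mu)$, the residue of $\omega$ at $\zeta^\mu$ is $$\operatorname{Res}_{\mathbf z=\zeta^\mu}\omega(\tau,\mathbf z)=\operatorname{sign}(\det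 B_I)\,\frac{(\zeta^\mu)^\tau}{J_I(\zeta^\mu)\prod_{j\notin I}f_j(\zeta^\mu)},\qquad J_I=\det\Big(z_k\frac{\partial f_i}{\partial z_k}\Big)_{1\le k\le d,\ i\in I}.$$ **Proposition.** Let $\mathcal I$ and $\mathcal J$ be adjacent cotriangulations with common wall $W$, and let $\tau\in\mathbb Z^d$ lie in the open zonotope $Z_B^\circ=\{\sum_{i=1}^N\nu_i\mathbf b_i: 0<\nu_i<1\}$. Then the sets of solution points $\mu$ with $I(\mu)\in\mathcal I_W$ and $\nu$ with $I(\nu)\in\mathcal J_W$ are finite, and $$\sum_{\mu:\,I(\mu)\in\mathcal I_W}\operatorname{Res}_{\mathbf z=\zeta^\mu}\omega(\tau,\mathbf z)=\sum_{\nu:\,I(\nu)\in\mathcal J_W}\operatorname{Res}_{\mathbf z=\zeta^\nu}\omega(\tau,\mathbf z).$$ -/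

import Mathlib

open scoped BigOperators Matrix

noncomputable section

namespace AHyp

variable {r d N : ℕ}

/-- The lattice of integer relations between the columns of `A` (the integer kernel of `A`). -/
def relationLattice (A : Matrix (Fin r) (Fin N) ℤ) : Submodule ℤ (Fin N → ℤ) :=
  LinearMap.ker A.mulVecLin

/-- `B` is a Gale dual of `A`: the rows of `B` form a `ℤ`-basis of the integer kernel of `A`. -/
structure IsGaleDual (A : Matrix (Fin r) (Fin N) ℤ) (B : Matrix (Fin d) (Fin N) ℤ) : Prop where
  linearIndependent : LinearIndependent ℤ (fun k : Fin d => B k)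
  span_eq : Submodule.span ℤ (Set.range (fun k : Fin d => B k)) = relationLattice A

/-- The `i`-th column of an integer matrix, as a real vector. -/
def realCol {m n : ℕ} (M : Matrix (Fin m) (Fin n) ℤ) (i : Fin n) : Fin m → ℝ :=
  fun k => (M k i : ℝ)

/-- The closed convex cone generated by the columns of `M` with index in `I`. -/
def colCone {m n : ℕ} (M : Matrix (Fin m) (Fin n) ℤ) (I : Finset (Fin n)) :
    PointedCone ℝ (Fin m → ℝ) :=
  PointedCone.hull ℝ (realCol M '' (I : Set (Fin n)))

/-- Total non-resonance of the parameter vector `α`: no cone generated by `r - 1` linearly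
independent columns of `A` meets the translated lattice `α + ℤ^r`. -/
def IsTotallyNonresonant (A : Matrix (Fin r) (Fin N) ℤ) (α : Fin r → ℝ) : Prop :=
  ∀ J : Finset (Fin N), J.card + 1 = r →
    LinearIndependent ℝ (fun j : J => realCol A j) →
    ∀ m : Fin r → ℤ, (fun k => α k + (m k : ℝ)) ∉ colCone A J

/-- A cotriangle: a set of `d` indices whose columns of `B` are linearly independent. -/
def IsCotriangle (B : Matrix (Fin d) (Fin N) ℤ) (I : Finset (Fin N)) : Prop :=
  I.card = d ∧ LinearIndependent ℝ (fun i : I => realCol B i)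

/-- A convergence direction: a vector outside the span of any `d - 1` columns of `B`. -/
def IsConvergenceDirection (B : Matrix (Fin d) (Fin N) ℤ) (ρ : Fin d → ℝ) : Prop :=
  ∀ K : Finset (Fin N), K.card + 1 = d →
    ρ ∉ Submodule.span ℝ (realCol B '' (K : Set (Fin N)))

/-- The set of cotriangles whose cone contains `ρ`. -/
def cotriangulationOf (B : Matrix (Fin d) (Fin N) ℤ) (ρ : Fin d → ℝ) : Set (Finset (Fin N)) :=
  {I | IsCotriangle B I ∧ ρ ∈ colCone B I}

/-- A cotriangulation of `B`: the set of cotriangles attached to some convergence direction. -/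
def IsCotriangulation (B : Matrix (Fin d) (Fin N) ℤ) (T : Set (Finset (Fin N))) : Prop :=
  ∃ ρ : Fin d → ℝ, IsConvergenceDirection B ρ ∧ T = cotriangulationOf B ρ

/-- The chamber of a cotriangulation: the intersection of the cones of its cotriangles. -/
def chamber (B : Matrix (Fin d) (Fin N) ℤ) (T : Set (Finset (Fin N))) :
    PointedCone ℝ (Fin d → ℝ) :=
  ⨅ I ∈ T, colCone B I

/-- `F` is a face of `C` whose linear span has codimension `1` in `ℝ^d`. -/
def IsCodimOneFace (F C : PointedCone ℝ (Fin d → ℝ)) : Prop :=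
  F.IsFaceOf C ∧
    Module.finrank ℝ (Submodule.span ℝ (F : Set (Fin d → ℝ))) + 1 = d

/-- `W` is a common wall of the cotriangulations `T` and `T'`: a codimension-one face of both
chambers.  Two cotriangulations are adjacent when they have a common wall. -/
def IsCommonWall (B : Matrix (Fin d) (Fin N) ℤ) (T T' : Set (Finset (Fin N)))
    (W : PointedCone ℝ (Fin d → ℝ)) : Prop :=
  IsCodimOneFace W (chamber B T) ∧ IsCodimOneFace W (chamber B T')

/-- The cotriangles of `T` whose cone has `W` as a (sub-)face: `W` is contained in a
codimension-one face of the cone. -/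
def cotrianglesAtWall (B : Matrix (Fin d) (Fin N) ℤ) (T : Set (Finset (Fin N)))
    (W : PointedCone ℝ (Fin d → ℝ)) : Set (Finset (Fin N)) :=
  {I | I ∈ T ∧ ∃ F : PointedCone ℝ (Fin d → ℝ), IsCodimOneFace F (colCone B I) ∧ W ≤ F}

/-- The open zonotope of `B`. -/
def openZonotope (B : Matrix (Fin d) (Fin N) ℤ) : Set (Fin d → ℝ) :=
  {t | ∃ ν : Fin N → ℝ, (∀ i, 0 < ν i ∧ ν i < 1) ∧ t = ∑ i, ν i • realCol B i}

/-- The parameter vector `γ^μ = γ₀ + μ B`. -/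
def gammaShift (B : Matrix (Fin d) (Fin N) ℤ) (γ₀ : Fin N → ℝ) (μ : Fin d → ℝ) : Fin N → ℝ :=
  fun i => γ₀ i + ∑ k, μ k * (B k i : ℝ)

/-- `I` is a cotriangle at all of whose indices `γ^μ` is an integer. -/
def IsCotriangleAt (B : Matrix (Fin d) (Fin N) ℤ) (γ₀ : Fin N → ℝ) (μ : Fin d → ℝ)
    (I : Finset (Fin N)) : Prop :=
  IsCotriangle B I ∧ ∀ i ∈ I, ∃ m : ℤ, gammaShift B γ₀ μ i = m

/-- A solution point: `μ ∈ [0,1)^d` such that `γ^μ` is integral along some cotriangle. -/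
def IsSolutionPoint (B : Matrix (Fin d) (Fin N) ℤ) (γ₀ : Fin N → ℝ) (μ : Fin d → ℝ) : Prop :=
  (∀ k, 0 ≤ μ k ∧ μ k < 1) ∧ ∃ I, IsCotriangleAt B γ₀ μ I

open Classical in
/-- The cotriangle `I(μ)` of a solution point `μ`; it is unique when the parameter vector is
totally non-resonant.  (Points that are not solution points get the value `∅`.) -/
def solutionCotriangle (B : Matrix (Fin d) (Fin N) ℤ) (γ₀ : Fin N → ℝ) (μ : Fin d → ℝ) :
    Finset (Fin N) :=
  if h : ∃ I, IsCotriangleAt B γ₀ μ I then h.choose else ∅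

/-- The solution points whose cotriangle lies in the collection `S`. -/
def solutionPoints (B : Matrix (Fin d) (Fin N) ℤ) (γ₀ : Fin N → ℝ) (S : Set (Finset (Fin N))) :
    Set (Fin d → ℝ) :=
  {μ | IsSolutionPoint B γ₀ μ ∧ solutionCotriangle B γ₀ μ ∈ S}

/-- The point `ζ^μ = exp(2πiμ)`, coordinate by coordinate. -/
def zetaPoint (μ : Fin d → ℝ) : Fin d → ℂ :=
  fun k => Complex.exp (2 * Real.pi * Complex.I * (μ k : ℂ))

/-- The Laurent monomial `z^b`. -/
def monomialAt (b : Fin d → ℤ) (z : Fin d → ℂ) : ℂ :=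
  ∏ k, z k ^ b k

/-- The binomial `f_i(z) = x_i z^{b_i} - 1` with `x_i = exp(2πi γ₀_i)`. -/
def binomialFactor (B : Matrix (Fin d) (Fin N) ℤ) (γ₀ : Fin N → ℝ) (i : Fin N)
    (z : Fin d → ℂ) : ℂ :=
  Complex.exp (2 * Real.pi * Complex.I * (γ₀ i : ℂ)) * monomialAt (fun k => B k i) z - 1

/-- The square submatrix `B_I` of `B` on the columns in `I`, in increasing order. -/
def subB (B : Matrix (Fin d) (Fin N) ℤ) (I : Finset (Fin N)) (h : I.card = d) :
    Matrix (Fin d) (Fin d) ℤ :=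
  B.submatrix id (I.orderEmbOfFin h)

/-- The Jacobian determinant `J_I(z) = det (z_k ∂f_{I_c}/∂z_k)_{k,c}` of the functions `f_i`,
`i ∈ I`, with respect to the logarithmic derivations `z_k ∂/∂z_k`. -/
def logJacobian (B : Matrix (Fin d) (Fin N) ℤ) (γ₀ : Fin N → ℝ) (I : Finset (Fin N))
    (h : I.card = d) (z : Fin d → ℂ) : ℂ :=
  Matrix.det (Matrix.of fun k c : Fin d =>
    z k * deriv (fun t : ℂ => binomialFactor B γ₀ (I.orderEmbOfFin h c) (Function.update z k t))
      (z k))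

/-- The residue of
`ω(τ,z) = z^τ / (f_1(z) ⋯ f_N(z)) · (dz_1/z_1 ∧ ⋯ ∧ dz_d/z_d)`
at a nondegenerate common zero `z` of the `f_i`, `i ∈ I`: the value at `z` of
`sign(det B_I) · z^τ / (J_I ∏_{j ∉ I} f_j)`. -/
def residueAt (B : Matrix (Fin d) (Fin N) ℤ) (γ₀ : Fin N → ℝ) (τ : Fin d → ℤ)
    (I : Finset (Fin N)) (z : Fin d → ℂ) : ℂ :=
  if h : I.card = d then
    ((subB B I h).det.sign : ℂ) *
      (monomialAt τ z / (logJacobian B γ₀ I h z * ∏ j ∈ Iᶜ, binomialFactor B γ₀ j z))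
  else 0

/-- The residue of `ω(τ,z)` at the point `ζ^μ` of a solution point `μ`. -/
def omegaResidue (B : Matrix (Fin d) (Fin N) ℤ) (γ₀ : Fin N → ℝ) (τ : Fin d → ℤ)
    (μ : Fin d → ℝ) : ℂ :=
  residueAt B γ₀ τ (solutionCotriangle B γ₀ μ) (zetaPoint μ)

end AHyp

end

noncomputable section

namespace AHyp

variable {r d N : ℕ}

/-! If neither cotriangulation has a cotriangle at the wall, both sums are empty. Otherwise a facet
of such a cotriangle shows that the span of `W` is the kernel of a primitive integral form `h`; put
n_j = h · b_j. The cotriangles at `W` are exactly the sets K ∪ {i} with K in this hyperplane, `W`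
inside the cone of K, and b_i strictly on the side of ρ (`mem_cotrianglesAtWall_iff`). Both
cotriangulations thus share the facets K and differ at most in the sign required of n_i. That all
these sets do belong to the cotriangulation comes from linear programming duality.

Fix K. The equations f_k = 0, k ∈ K, cut out translates w t^h of a one-parameter subgroup. On such a
curve the factors with n_j = 0 are constant and the others become a_j t^(n_j) - 1, so ω induces a
constant times t^m / ∏ (a_j t^(n_j) - 1) · dt/t with m = h · τ. The zeros of the i-th factor are the
solution points with cotriangle K ∪ {i}. As |det B_(K ∪ {i})| is proportional to |n_i|, the
one-variable residue there is sign(n_i) times the residue of ω (`signed_residue_eq`). Total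
non-resonance keeps the zeros of different factors apart, so all poles are simple
(`IsCotriangleAt.unique`). The zonotope condition gives -∑ n_j⁻ < m < ∑ n_j⁺, which excludes poles
at 0 and ∞. Hence the signed residues on each curve sum to zero (`sum_residues_eq_zero`), and over
all curves the residues with n_i > 0 balance those with n_i < 0. -/

/-! ### Coordinates with respect to cotriangles -/

theorem mem_span_image_iff {ι V : Type*} [Fintype ι] [AddCommGroup V] [Module ℝ V]
    (v : ι → V) (I : Finset ι) (x : V) :
    x ∈ Submodule.span ℝ (v '' (I : Set ι)) ↔
      ∃ c : ι → ℝ, (∀ i ∉ I, c i = 0) ∧ ∑ i, c i • v i = x := by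
  classical
  rw [Submodule.mem_span_image_finset_iff_exists_fun']
  constructor
  · rintro ⟨c, rfl⟩
    refine ⟨fun i => if i ∈ I then c i else 0, fun i hi => by simp [hi], ?_⟩
    simp [ite_smul, Finset.sum_ite_mem]
  · rintro ⟨c, hc, rfl⟩
    exact ⟨c, Finset.sum_subset (Finset.subset_univ I) fun i _ hi => by simp [hc i hi]⟩

theorem mem_hull_image_iff {ι V : Type*} [Fintype ι] [AddCommGroup V] [Module ℝ V]
    (v : ι → V) (I : Finset ι) (x : V) :
    x ∈ PointedCone.hull ℝ (v '' (I : Set ι)) ↔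
      ∃ c : ι → ℝ, (∀ i, 0 ≤ c i) ∧ (∀ i ∉ I, c i = 0) ∧ ∑ i, c i • v i = x := by
  classical
  rw [PointedCone.hull, Submodule.mem_span_image_finset_iff_exists_fun']
  constructor
  · rintro ⟨c, rfl⟩
    refine ⟨fun i => if i ∈ I then (c i : ℝ) else 0, fun i => ?_, fun i hi => by simp [hi], ?_⟩
    · dsimp only
      split_ifs
      · exact (c i).2
      · exact le_rfl
    · simp only [ite_smul, zero_smul, Finset.sum_ite_mem, Finset.univ_inter]
      rfl
  · rintro ⟨c, h0, hc, rfl⟩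
    refine ⟨fun i => ⟨c i, h0 i⟩, ?_⟩
    exact Finset.sum_subset (Finset.subset_univ I) fun i _ hi => by simp [hc i hi]

theorem linearIndependent_iff_sum {ι V : Type*} [Fintype ι] [AddCommGroup V] [Module ℝ V]
    (v : ι → V) (I : Finset ι) :
    LinearIndependent ℝ (fun i : I => v i) ↔
      ∀ c : ι → ℝ, (∀ i ∉ I, c i = 0) → ∑ i, c i • v i = 0 → c = 0 := by
  classical
  have key : LinearIndependent ℝ (fun i : I => v i) ↔ LinearIndepOn ℝ v (I : Set ι) := Iff.rfl
  rw [key, linearIndepOn_finset_iff]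
  constructor
  · intro h c hc hs
    funext i
    by_cases hi : i ∈ I
    · refine h c ?_ i hi
      rw [← hs]
      exact Finset.sum_subset (Finset.subset_univ I) fun i _ hi => by simp [hc i hi]
    · exact hc i hi
  · intro h c hs i hi
    have := h (fun i => if i ∈ I then c i else 0) (fun i hi => by simp [hi])
      (by simpa [ite_smul, Finset.sum_ite_mem] using hs)
    simpa [hi] using congrFun this i

theorem IsCotriangle.eq_zero_of_sum {B : Matrix (Fin d) (Fin N) ℤ} {I : Finset (Fin N)}
    (hI : IsCotriangle B I) {c : Fin N → ℝ} (hc : ∀ i ∉ I, c i = 0)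
    (hs : ∑ i, c i • realCol B i = 0) : c = 0 :=
  (linearIndependent_iff_sum _ _).1 hI.2 c hc hs

theorem IsCotriangle.coeff_ext {B : Matrix (Fin d) (Fin N) ℤ} {I : Finset (Fin N)}
    (hI : IsCotriangle B I) {c c' : Fin N → ℝ} (hc : ∀ i ∉ I, c i = 0) (hc' : ∀ i ∉ I, c' i = 0)
    (hs : ∑ i, c i • realCol B i = ∑ i, c' i • realCol B i) : c = c' := by
  refine sub_eq_zero.1 (hI.eq_zero_of_sum (c := c - c') (fun i hi => ?_) ?_)
  · simp [hc i hi, hc' i hi]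
  · simp [sub_smul, hs]

theorem IsCotriangle.span_eq_top {B : Matrix (Fin d) (Fin N) ℤ} {I : Finset (Fin N)}
    (hI : IsCotriangle B I) : Submodule.span ℝ (realCol B '' (I : Set (Fin N))) = ⊤ := by
  have h := hI.2.span_eq_top_of_card_eq_finrank' (by simp [hI.1])
  rw [← h, Set.image_eq_range]
  rfl

theorem IsCotriangle.exists_sum_eq {B : Matrix (Fin d) (Fin N) ℤ} {I : Finset (Fin N)}
    (hI : IsCotriangle B I) (x : Fin d → ℝ) :
    ∃ c : Fin N → ℝ, (∀ i ∉ I, c i = 0) ∧ ∑ i, c i • realCol B i = x := by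
  rw [← mem_span_image_iff, hI.span_eq_top]
  trivial

theorem IsCotriangle.linearMap_ext {B : Matrix (Fin d) (Fin N) ℤ} {I : Finset (Fin N)}
    (hI : IsCotriangle B I) {φ ψ : (Fin d → ℝ) →ₗ[ℝ] ℝ}
    (h : ∀ i ∈ I, φ (realCol B i) = ψ (realCol B i)) : φ = ψ := by
  refine LinearMap.ext_on hI.span_eq_top ?_
  rintro _ ⟨i, hi, rfl⟩
  exact h i hi

theorem IsCotriangle.exists_linearMap {B : Matrix (Fin d) (Fin N) ℤ} {I : Finset (Fin N)}
    (hI : IsCotriangle B I) (y : Fin N → ℝ) :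
    ∃ φ : (Fin d → ℝ) →ₗ[ℝ] ℝ, ∀ i ∈ I, φ (realCol B i) = y i := by
  let b := Module.Basis.mk hI.2 (by rw [← hI.span_eq_top, Set.image_eq_range]; exact le_rfl)
  refine ⟨b.constr ℝ fun i => y i, fun i hi => ?_⟩
  have := b.constr_basis ℝ (fun i => y i) ⟨i, hi⟩
  rwa [Module.Basis.mk_apply] at this

theorem mem_colCone_iff {B : Matrix (Fin d) (Fin N) ℤ} {I : Finset (Fin N)} {x : Fin d → ℝ} :
    x ∈ colCone B I ↔
      ∃ c : Fin N → ℝ, (∀ i, 0 ≤ c i) ∧ (∀ i ∉ I, c i = 0) ∧ ∑ i, c i • realCol B i = x :=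
  mem_hull_image_iff _ _ _

/-- Replacing an index of a cotriangle by another one whose column involves the replaced column
gives a cotriangle. -/
theorem IsCotriangle.exchange {B : Matrix (Fin d) (Fin N) ℤ} {I : Finset (Fin N)}
    (hI : IsCotriangle B I) {j k : Fin N} (hk : k ∈ I) (hj : j ∉ I) {β : Fin N → ℝ}
    (hβ : ∀ i ∉ I, β i = 0) (hβs : ∑ i, β i • realCol B i = realCol B j) (hβk : β k ≠ 0) :
    IsCotriangle B (insert j (I.erase k)) := by
  refine ⟨?_, (linearIndependent_iff_sum _ _).2 fun c hc hs => ?_⟩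
  · rw [Finset.card_insert_of_notMem (by simp [hj]), Finset.card_erase_of_mem hk, hI.1]
    have := hI.1 ▸ Finset.card_pos.2 ⟨k, hk⟩
    omega
  · have hjk : j ≠ k := fun h => hj (h ▸ hk)
    have h1 : (fun i => c i - c j * Pi.single (M := fun _ => ℝ) j 1 i + c j * β i) = 0 := by
      refine hI.eq_zero_of_sum (fun i hi => ?_) ?_
      · by_cases hij : i = j
        · subst hij; simp [hβ i hi]
        · have : i ∉ insert j (I.erase k) := by simp [hij, hi]
          simp [hβ i hi, hc i this, hij]
      · simp only [add_smul, sub_smul, mul_smul, Finset.sum_add_distrib, Finset.sum_sub_distrib,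
          ← Finset.smul_sum, hs, hβs]
        simp [Pi.single_apply, ite_smul]
    have hck : c k = 0 := hc k (by simp [hjk.symm])
    have h2 := congrFun h1 k
    simp only [hck, Pi.single_apply, hjk.symm, if_false, Pi.zero_apply, mul_zero, sub_zero,
      zero_add, mul_eq_zero, hβk, or_false] at h2
    funext i
    simpa [h2] using congrFun h1 i

/-! ### Linear programming over a cotriangulation -/

/-- A zero coordinate would put ρ in the span of d - 1 columns. In the language of linear
programming, no basic solution is degenerate, so a pivot on a column of negative reduced cost
strictly lowers the cost. -/
theorem IsConvergenceDirection.coeff_pos {B : Matrix (Fin d) (Fin N) ℤ} {ρ : Fin d → ℝ}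
    (hρ : IsConvergenceDirection B ρ) {I : Finset (Fin N)} (hI : IsCotriangle B I)
    {c : Fin N → ℝ} (h0 : ∀ i, 0 ≤ c i) (hc : ∀ i ∉ I, c i = 0)
    (hs : ∑ i, c i • realCol B i = ρ) {i : Fin N} (hi : i ∈ I) : 0 < c i := by
  refine lt_of_le_of_ne (h0 i) fun h => hρ (I.erase i) ?_ ?_
  · rw [Finset.card_erase_add_one hi, hI.1]
  · rw [mem_span_image_iff]
    refine ⟨c, fun j hj => ?_, hs⟩
    by_cases hji : j = i
    · rw [hji, ← h]
    · exact hc j fun hj' => hj (Finset.mem_erase.2 ⟨hji, hj'⟩)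

/-- An optimal basis of the linear program `min y · p` over `p ≥ 0`, `∑ p_i b_i = ρ`. -/
theorem exists_optimal_cotriangle {B : Matrix (Fin d) (Fin N) ℤ} {ρ : Fin d → ℝ}
    (hρ : IsConvergenceDirection B ρ) (hne : (cotriangulationOf B ρ).Nonempty)
    {y : Fin N → ℝ} (hy : ∀ i, 0 ≤ y i) :
    ∃ I ∈ cotriangulationOf B ρ, ∃ φ : (Fin d → ℝ) →ₗ[ℝ] ℝ,
      (∀ i ∈ I, φ (realCol B i) = -y i) ∧ ∀ i, -y i ≤ φ (realCol B i) := by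
  classical
  -- The cotriangles of ρ are the feasible bases; the cheapest one is chosen and `φ` is, up to sign,
  -- its dual solution. A column violating the dual inequality would allow a simplex pivot.
  have hex : ∀ I ∈ cotriangulationOf B ρ, ∃ c : Fin N → ℝ, (∀ i, 0 ≤ c i) ∧
      (∀ i ∉ I, c i = 0) ∧ ∑ i, c i • realCol B i = ρ := fun I hI => mem_colCone_iff.1 hI.2
  choose! p hp0 hpI hps using hex
  obtain ⟨I, hI, hmin⟩ := Set.exists_min_image (cotriangulationOf B ρ) (fun I => ∑ i, p I i * y i)
    (Set.toFinite _) hne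
  obtain ⟨φ, hφ⟩ := hI.1.exists_linearMap (fun i => -y i)
  refine ⟨I, hI, φ, hφ, ?_⟩
  by_contra! hcon
  obtain ⟨j, hj⟩ := hcon
  have hjI : j ∉ I := fun h => by rw [hφ j h] at hj; exact lt_irrefl _ hj
  obtain ⟨β, hβ, hβs⟩ := hI.1.exists_sum_eq (realCol B j)
  have hφj : φ (realCol B j) = -∑ i, β i * y i := by
    rw [← hβs, map_sum, ← Finset.sum_neg_distrib]
    refine Finset.sum_congr rfl fun i _ => ?_
    by_cases hi : i ∈ I
    · rw [map_smul, hφ i hi]; simp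
    · simp [hβ i hi]
  -- The feasible line on which column `j` enters: the sum stays ρ and the cost changes at the
  -- negative rate `y j + φ (realCol B j)`.
  let q : ℝ → Fin N → ℝ := fun t i => p I i + t * (Pi.single (M := fun _ => ℝ) j 1 i - β i)
  have hqs : ∀ t, ∑ i, q t i • realCol B i = ρ := fun t => by
    simp only [q, add_smul, mul_smul, sub_smul, Finset.sum_add_distrib, ← Finset.smul_sum,
      Finset.sum_sub_distrib, hβs, hps I hI]
    simp [Pi.single_apply, ite_smul]
  have hqc : ∀ t, ∑ i, q t i * y i = ∑ i, p I i * y i + t * (y j + φ (realCol B j)) := fun t => by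
    simp only [q, add_mul, mul_assoc, sub_mul, Finset.sum_add_distrib, ← Finset.mul_sum,
      Finset.sum_sub_distrib, hφj]
    simp [Pi.single_apply, sub_eq_add_neg]
  have hneg : y j + φ (realCol B j) < 0 := by linarith
  by_cases hβpos : ∃ i ∈ I, 0 < β i
  · obtain ⟨k, hk, hkmin⟩ := Finset.exists_min_image (I.filter fun i => 0 < β i)
      (fun i => p I i / β i) (by simpa [Finset.Nonempty] using hβpos)
    rw [Finset.mem_filter] at hk
    set t := p I k / β k with ht
    have htpos : 0 < t := div_pos (hρ.coeff_pos hI.1 (hp0 I hI) (hpI I hI) (hps I hI) hk.1) hk.2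
    have hex := hI.1.exchange hk.1 hjI hβ hβs hk.2.ne'
    have hq0 : ∀ i, 0 ≤ q t i := fun i => by
      by_cases hij : i = j
      · subst hij
        simp [q, hpI I hI i hjI, hβ i hjI, htpos.le]
      · simp only [q, Pi.single_apply, hij, if_false, zero_sub]
        rcases le_or_gt (β i) 0 with hβi | hβi
        · nlinarith [hp0 I hI i, mul_nonneg htpos.le (neg_nonneg.2 hβi)]
        · have hiI : i ∈ I := by
            by_contra h; rw [hβ i h] at hβi; exact lt_irrefl _ hβi
          have := hkmin i (Finset.mem_filter.2 ⟨hiI, hβi⟩)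
          rw [le_div_iff₀ hβi] at this
          linarith
    have hqI : ∀ i ∉ insert j (I.erase k), q t i = 0 := fun i hi => by
      simp only [Finset.mem_insert, Finset.mem_erase, not_or, not_and] at hi
      by_cases hik : i = k
      · subst hik
        simp only [q, Pi.single_apply, hi.1, if_false, zero_sub, ht]
        field_simp [hk.2.ne']
        simp
      · simp [q, Pi.single_apply, hi.1, hpI I hI i (hi.2 hik), hβ i (hi.2 hik)]
    have hI1 : insert j (I.erase k) ∈ cotriangulationOf B ρ :=
      ⟨hex, mem_colCone_iff.2 ⟨q t, hq0, hqI, hqs t⟩⟩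
    have heq : p (insert j (I.erase k)) = q t :=
      hex.coeff_ext (hpI _ hI1) hqI ((hps _ hI1).trans (hqs t).symm)
    have := hmin _ hI1
    simp only [heq, hqc] at this
    nlinarith
  -- No coordinate ever decreases, so the whole ray is feasible and its cost tends to -∞, although
  -- `y` is nonnegative.
  · push Not at hβpos
    have hβ0 : ∀ i, β i ≤ 0 := fun i => by
      by_cases hi : i ∈ I
      · exact hβpos i hi
      · exact (hβ i hi).le
    have hcost : ∀ t, 0 ≤ t → 0 ≤ ∑ i, q t i * y i := fun t ht =>
      Finset.sum_nonneg fun i _ => mul_nonneg (add_nonneg (hp0 I hI i)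
        (mul_nonneg ht (sub_nonneg.2 ((hβ0 i).trans (by
          rw [Pi.single_apply]; split_ifs <;> norm_num))))) (hy i)
    have hc0 : 0 ≤ ∑ i, p I i * y i :=
      Finset.sum_nonneg fun i _ => mul_nonneg (hp0 I hI i) (hy i)
    set C := ∑ i, p I i * y i
    have hpos : 0 < -(y j + φ (realCol B j)) := by linarith
    -- At this parameter the cost equals -1.
    have h1 := hcost ((C + 1) / -(y j + φ (realCol B j))) (by positivity)
    rw [hqc] at h1
    have h2 : (C + 1) / -(y j + φ (realCol B j)) * (y j + φ (realCol B j)) = -(C + 1) := by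
      rw [div_neg, neg_mul, div_mul_cancel₀ _ hneg.ne]
    linarith

/-- A cotriangle in which `x` has positive coordinates belongs to the cotriangulation of `ρ` as
soon as `x` lies in the chamber of that cotriangulation. -/
theorem mem_cotriangulationOf_of_pos {B : Matrix (Fin d) (Fin N) ℤ} {ρ x : Fin d → ℝ}
    (hρ : IsConvergenceDirection B ρ) (hne : (cotriangulationOf B ρ).Nonempty)
    (hx : ∀ J ∈ cotriangulationOf B ρ, x ∈ colCone B J)
    {I : Finset (Fin N)} (hI : IsCotriangle B I) {c : Fin N → ℝ} (hc : ∀ i ∉ I, c i = 0)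
    (hpos : ∀ i ∈ I, 0 < c i) (hs : ∑ i, c i • realCol B i = x) :
    I ∈ cotriangulationOf B ρ := by
  classical
  -- The cost is the indicator of the complement of `I`. The dual form is nonnegative on `I` but
  -- nonpositive at `x`, which is interior to the cone of `I`; hence it vanishes, and the optimal
  -- `J` can use no column outside `I`.
  obtain ⟨J, hJ, φ, hφJ, hφ⟩ := exists_optimal_cotriangle hρ hne
    (y := fun i => if i ∈ I then 0 else 1) (fun i => by positivity)
  obtain ⟨e, he0, heJ, hes⟩ := mem_colCone_iff.1 (hx J hJ)
  have h1 : φ x ≤ 0 := by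
    rw [← hes, map_sum]
    refine Finset.sum_nonpos fun i _ => ?_
    by_cases hi : i ∈ J
    · rw [map_smul, hφJ i hi, smul_eq_mul]
      have := he0 i
      split_ifs <;> simp [this]
    · simp [heJ i hi]
  have hφI : ∀ i ∈ I, 0 ≤ φ (realCol B i) := fun i hi => by simpa [hi] using hφ i
  have hterm : ∀ i, 0 ≤ c i * φ (realCol B i) := fun i => by
    by_cases hi : i ∈ I
    · exact mul_nonneg (hpos i hi).le (hφI i hi)
    · simp [hc i hi]
  have h2 : ∑ i, c i * φ (realCol B i) = 0 := by
    refine le_antisymm ?_ (Finset.sum_nonneg fun i _ => hterm i)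
    rw [← hs, map_sum] at h1
    simpa using h1
  have hφ0 : φ = 0 := hI.linearMap_ext fun i hi => by
    have := (Finset.sum_eq_zero_iff_of_nonneg fun i _ => hterm i).1 h2 i (Finset.mem_univ i)
    simpa [(hpos i hi).ne'] using this
  have hsub : J ⊆ I := fun i hi => by
    by_contra hiI
    have := hφJ i hi
    simp [hφ0, hiI] at this
  have : J = I := Finset.eq_of_subset_of_card_le hsub (by rw [hI.1, hJ.1.1])
  exact this ▸ hJ

/-! ### Cotriangles at a wall -/

theorem finrank_span_realCol_le (B : Matrix (Fin d) (Fin N) ℤ) (K : Finset (Fin N)) :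
    Module.finrank ℝ (Submodule.span ℝ (realCol B '' (K : Set (Fin N)))) ≤ K.card := by
  classical
  rw [← Finset.coe_image]
  exact (finrank_span_finset_le_card _).trans Finset.card_image_le

/-- The empty intersection of cones is the whole space, whose only face is itself, and that has
codimension 0. -/
theorem IsCodimOneFace.cotriangulationOf_nonempty {B : Matrix (Fin d) (Fin N) ℤ}
    {T : Set (Finset (Fin N))} {W : PointedCone ℝ (Fin d → ℝ)}
    (hW : IsCodimOneFace W (chamber B T)) : T.Nonempty := by
  by_contra hT
  rw [Set.not_nonempty_iff_eq_empty] at hT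
  subst hT
  have hall : ∀ x, x ∈ W := fun x =>
    hW.1.mem_of_add_mem_left (x := x) (y := -x) (by simp [chamber]) (by simp [chamber])
      (by simp)
  have : (W : Set (Fin d → ℝ)) = Set.univ := Set.eq_univ_of_forall hall
  have h2 := hW.2
  rw [this, Submodule.span_univ, finrank_top] at h2
  simp at h2

/-- A cotriangle at a wall has a facet spanning the wall hyperplane and containing the wall. -/
theorem exists_facet_of_mem_cotrianglesAtWall {B : Matrix (Fin d) (Fin N) ℤ} {ρ : Fin d → ℝ}
    {W : PointedCone ℝ (Fin d → ℝ)}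
    (hWd : Module.finrank ℝ (Submodule.span ℝ (W : Set (Fin d → ℝ))) + 1 = d)
    {I : Finset (Fin N)} (hI : I ∈ cotrianglesAtWall B (cotriangulationOf B ρ) W) :
    ∃ i ∈ I, Submodule.span ℝ (W : Set (Fin d → ℝ)) =
      Submodule.span ℝ (realCol B '' ((I.erase i : Finset (Fin N)) : Set (Fin N))) ∧
      W ≤ colCone B (I.erase i) := by
  classical
  obtain ⟨⟨hI, -⟩, F, ⟨hF, hFd⟩, hWF⟩ := hI
  -- A face of a simplicial cone is generated by the generators it contains; counting dimensions
  -- then leaves exactly one index of `I` out.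
  set K := I.filter fun i => realCol B i ∈ F with hK
  have hFK : F ≤ colCone B K := fun x hx => by
    obtain ⟨c, h0, hcI, rfl⟩ := mem_colCone_iff.1 (hF.le hx)
    refine mem_colCone_iff.2 ⟨c, h0, fun i hi => ?_, rfl⟩
    by_contra hci
    have hiI : i ∈ I := by
      by_contra h; exact hci (hcI i h)
    refine hi (Finset.mem_filter.2 ⟨hiI, ?_⟩)
    have hmem : ∀ j, c j • realCol B j ∈ colCone B I := fun j => by
      refine mem_colCone_iff.2 ⟨Pi.single j (c j), fun i => ?_, fun i hi => ?_, ?_⟩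
      · rw [Pi.single_apply]; split_ifs; exacts [h0 j, le_rfl]
      · rw [Pi.single_apply]; split_ifs with h; exacts [hcI j (h ▸ hi), rfl]
      · simp [Pi.single_apply, ite_smul]
    have hi' := hF.mem_of_sum_mem (f := fun j => c j • realCol B j) hmem hx i
    have := PointedCone.smul_mem F (inv_nonneg.2 (h0 i)) hi'
    rwa [inv_smul_smul₀ hci] at this
  have hFKs : Submodule.span ℝ (F : Set (Fin d → ℝ)) ≤
      Submodule.span ℝ (realCol B '' (K : Set (Fin N))) := by
    refine Submodule.span_le.2 fun x hx => ?_
    obtain ⟨c, -, hc, hs⟩ := mem_colCone_iff.1 (hFK hx)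
    exact (mem_span_image_iff _ _ _).2 ⟨c, hc, hs⟩
  have hle := Submodule.finrank_mono hFKs
  have hKcard := finrank_span_realCol_le B K
  have hKI : K ≠ I := fun h => by
    have htop : Submodule.span ℝ (F : Set (Fin d → ℝ)) = ⊤ := by
      rw [eq_top_iff, ← hI.span_eq_top]
      refine Submodule.span_mono ?_
      rintro _ ⟨i, hi, rfl⟩
      rw [Finset.mem_coe, ← h] at hi
      exact (Finset.mem_filter.1 hi).2
    rw [htop, finrank_top] at hFd
    simp at hFd
  obtain ⟨i, hi, hiK⟩ := Finset.exists_of_ssubset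
    (Finset.ssubset_iff_subset_ne.2 ⟨Finset.filter_subset _ _, hKI⟩)
  have hKe : K = I.erase i := by
    refine Finset.eq_of_subset_of_card_le (fun k hk => Finset.mem_erase.2 ⟨?_, ?_⟩) ?_
    · rintro rfl; exact hiK hk
    · exact (Finset.mem_filter.1 hk).1
    · rw [Finset.card_erase_of_mem hi, hI.1]; omega
  have hKc : K.card + 1 = d := by rw [hKe, Finset.card_erase_add_one hi, hI.1]
  refine ⟨i, hi, ?_, hKe ▸ hWF.trans hFK⟩
  rw [← hKe]
  refine Submodule.eq_of_le_of_finrank_le ((Submodule.span_mono hWF).trans hFKs) ?_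
  omega

theorem facet_isFaceOf {B : Matrix (Fin d) (Fin N) ℤ} {I : Finset (Fin N)}
    (hI : IsCotriangle B I) {i : Fin N} (hi : i ∈ I) :
    IsCodimOneFace (colCone B (I.erase i)) (colCone B I) := by
  classical
  have hle : colCone B (I.erase i) ≤ colCone B I := fun x hx => by
    obtain ⟨c, h0, hc, hs⟩ := mem_colCone_iff.1 hx
    exact mem_colCone_iff.2 ⟨c, h0, fun j hj => hc j fun h => hj (Finset.mem_of_mem_erase h), hs⟩
  refine ⟨⟨hle, fun {x y a} hx hy ha hxy => ?_⟩, ?_⟩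
  · obtain ⟨c, h0, hc, rfl⟩ := mem_colCone_iff.1 hx
    obtain ⟨e, he0, he, rfl⟩ := mem_colCone_iff.1 hy
    obtain ⟨g, hg0, hg, hgs⟩ := mem_colCone_iff.1 hxy
    have heq : g = fun j => a * c j + e j := by
      refine hI.coeff_ext (fun j hj => hg j fun h => hj (Finset.mem_of_mem_erase h))
        (fun j hj => by simp [hc j hj, he j hj]) ?_
      simp only [hgs, add_smul, mul_smul, Finset.sum_add_distrib, Finset.smul_sum]
    refine mem_colCone_iff.2 ⟨c, h0, fun j hj => ?_, rfl⟩
    by_cases hji : j = i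
    · have h1 := congrFun heq j
      rw [hg j hj] at h1
      have h2 := mul_nonneg ha.le (h0 j)
      have h3 : a * c j = 0 := by linarith [he0 j]
      exact (mul_eq_zero.1 h3).resolve_left ha.ne'
    · exact hc j fun h => hj (Finset.mem_erase.2 ⟨hji, h⟩)
  · have hspan : Submodule.span ℝ (colCone B (I.erase i) : Set (Fin d → ℝ)) =
        Submodule.span ℝ (realCol B '' ((I.erase i : Finset (Fin N)) : Set (Fin N))) := by
      refine le_antisymm (Submodule.span_le.2 fun x hx => ?_) (Submodule.span_mono ?_)
      · obtain ⟨c, -, hc, hs⟩ := mem_colCone_iff.1 hx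
        exact (mem_span_image_iff _ _ _).2 ⟨c, hc, hs⟩
      · exact Submodule.subset_span
    have hind : LinearIndepOn ℝ (realCol B) ((I.erase i : Finset (Fin N)) : Set (Fin N)) :=
      (show LinearIndepOn ℝ (realCol B) (I : Set (Fin N)) from hI.2).mono
        (Finset.coe_subset.2 (Finset.erase_subset i I))
    have hcard := finrank_span_eq_card (R := ℝ)
      (b := fun k : ((I.erase i : Finset (Fin N)) : Set (Fin N)) => realCol B k) hind
    rw [hspan, Set.image_eq_range, hcard, ← hI.1, ← Finset.card_erase_add_one hi]
    exact congrArg (· + 1) (Fintype.card_coe (I.erase i))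

/-- If some coordinate vanished on all of `W`, the span of `W` would have dimension below `K.card`.
So every coordinate is positive somewhere on `W`, and adding such points makes all of them positive
at once. -/
theorem exists_mem_coeff_pos {B : Matrix (Fin d) (Fin N) ℤ} {W : PointedCone ℝ (Fin d → ℝ)}
    {K : Finset (Fin N)} (hWK : W ≤ colCone B K)
    (hWd : K.card ≤ Module.finrank ℝ (Submodule.span ℝ (W : Set (Fin d → ℝ)))) :
    ∃ w ∈ W, ∃ c : Fin N → ℝ, (∀ i ∉ K, c i = 0) ∧ (∀ i ∈ K, 0 < c i) ∧
      ∑ i, c i • realCol B i = w := by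
  classical
  have hk : ∀ k ∈ K, ∃ c : Fin N → ℝ, (∀ i, 0 ≤ c i) ∧ (∀ i ∉ K, c i = 0) ∧ 0 < c k ∧
      ∑ i, c i • realCol B i ∈ W := by
    intro k hk
    by_contra! hcon
    have hle : Submodule.span ℝ (W : Set (Fin d → ℝ)) ≤
        Submodule.span ℝ (realCol B '' ((K.erase k : Finset (Fin N)) : Set (Fin N))) := by
      refine Submodule.span_le.2 fun x hx => ?_
      obtain ⟨c, h0, hc, rfl⟩ := mem_colCone_iff.1 (hWK hx)
      refine (mem_span_image_iff _ _ _).2 ⟨c, fun i hi => ?_, rfl⟩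
      by_cases hik : i = k
      · subst hik
        by_contra hne
        exact hcon c h0 hc (lt_of_le_of_ne (h0 i) (Ne.symm hne)) hx
      · exact hc i fun h => hi (Finset.mem_erase.2 ⟨hik, h⟩)
    have h1 := Submodule.finrank_mono hle
    have h2 := finrank_span_realCol_le B (K.erase k)
    rw [Finset.card_erase_of_mem hk] at h2
    have := Finset.card_pos.2 ⟨k, hk⟩
    omega
  choose! c h0 hc hpos hmem using hk
  refine ⟨∑ k ∈ K, ∑ i, c k i • realCol B i, sum_mem fun k hk => hmem k hk,
    fun i => ∑ k ∈ K, c k i, fun i hi => Finset.sum_eq_zero fun k hk => hc k hk i hi,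
    fun i hi => ?_, ?_⟩
  · exact Finset.sum_pos' (fun k hk => h0 k hk i) ⟨i, hi, hpos i hi⟩
  · rw [Finset.sum_comm]
    exact Finset.sum_congr rfl fun i _ => Finset.sum_smul

/-- The cotriangles at a wall are those obtained from the simplicial cones of the wall hyperplane
containing the wall, by adding a column on the side of the cotriangulation. -/
theorem mem_cotrianglesAtWall_iff {B : Matrix (Fin d) (Fin N) ℤ} {ρ : Fin d → ℝ}
    (hρ : IsConvergenceDirection B ρ) {W : PointedCone ℝ (Fin d → ℝ)}
    (hW : IsCodimOneFace W (chamber B (cotriangulationOf B ρ)))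
    {φ : (Fin d → ℝ) →ₗ[ℝ] ℝ}
    (hker : Submodule.span ℝ (W : Set (Fin d → ℝ)) = LinearMap.ker φ) (hpos : 0 < φ ρ)
    {I : Finset (Fin N)} :
    I ∈ cotrianglesAtWall B (cotriangulationOf B ρ) W ↔
      IsCotriangle B I ∧ ∃ i ∈ I, 0 < φ (realCol B i) ∧
        (∀ k ∈ I.erase i, φ (realCol B k) = 0) ∧ W ≤ colCone B (I.erase i) := by
  classical
  constructor
  · intro h
    obtain ⟨i, hi, hspan, hWI⟩ := exists_facet_of_mem_cotrianglesAtWall hW.2 h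
    have hk : ∀ k ∈ I.erase i, φ (realCol B k) = 0 := fun k hk => by
      rw [← LinearMap.mem_ker, ← hker, hspan]
      exact Submodule.subset_span ⟨k, by exact_mod_cast hk, rfl⟩
    refine ⟨h.1.1, i, hi, ?_, hk, hWI⟩
    obtain ⟨c, h0, hc, hs⟩ := mem_colCone_iff.1 h.1.2
    have : φ ρ = c i * φ (realCol B i) := by
      rw [← hs, map_sum, Finset.sum_eq_single i]
      · simp
      · intro k _ hki
        by_cases hkI : k ∈ I
        · simp [hk k (Finset.mem_erase.2 ⟨hki, hkI⟩)]
        · simp [hc k hkI]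
      · simp
    rw [this] at hpos
    exact pos_of_mul_pos_right hpos (h0 i)
  · rintro ⟨hI, i, hi, hip, hk, hWI⟩
    refine ⟨?_, _, facet_isFaceOf hI hi, hWI⟩
    have hcard : (I.erase i).card + 1 = d := by rw [Finset.card_erase_add_one hi, hI.1]
    obtain ⟨w, hw, c, hc, hcp, hcs⟩ := exists_mem_coeff_pos hWI (by have := hW.2; omega)
    obtain ⟨e, he, hes⟩ := hI.exists_sum_eq ρ
    have hei : 0 < e i := by
      have : φ ρ = e i * φ (realCol B i) := by
        rw [← hes, map_sum, Finset.sum_eq_single i]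
        · simp
        · intro k _ hki
          by_cases hkI : k ∈ I
          · simp [hk k (Finset.mem_erase.2 ⟨hki, hkI⟩)]
          · simp [he k hkI]
        · simp
      rw [this] at hpos
      exact pos_of_mul_pos_left hpos hip.le
    have hq : ∀ k ∈ I.erase i, 0 ≤ |e k| / c k := fun k hk => by have := hcp k hk; positivity
    -- Chosen so that R c_k > |e_k| on the facet. Then R w + ρ still lies in every cone of the
    -- cotriangulation and is interior to the cone of `I`.
    set R := ∑ k ∈ I.erase i, |e k| / c k + 1 with hR
    have hR0 : 0 ≤ R := add_nonneg (Finset.sum_nonneg hq) zero_le_one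
    refine mem_cotriangulationOf_of_pos hρ hW.cotriangulationOf_nonempty (x := R • w + ρ)
      (fun J hJ => ?_) hI (c := fun k => R * c k + e k) (fun k hk => ?_) (fun k hkI => ?_) ?_
    · refine add_mem ?_ hJ.2
      have hle : W ≤ colCone B J := hW.1.le.trans (iInf₂_le J hJ)
      exact PointedCone.smul_mem _ hR0 (hle hw)
    · simp [he k hk, hc k fun h => hk (Finset.mem_of_mem_erase h)]
    · by_cases hki : k = i
      · subst hki
        simp [hc k (by simp), hei]
      · have hkK := Finset.mem_erase.2 ⟨hki, hkI⟩
        have h1 : |e k| / c k < R :=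
          lt_of_le_of_lt (Finset.single_le_sum hq hkK) (lt_add_one _)
        rw [div_lt_iff₀ (hcp k hkK)] at h1
        have := neg_abs_le (e k)
        linarith
    · simp only [add_smul, mul_smul, Finset.sum_add_distrib, ← Finset.smul_sum, hcs, hes]

/-! ### The residue theorem in one variable -/

open Polynomial in
-- Lagrange interpolation at the simple roots reproduces X^M. Up to the leading coefficient of `P`,
-- the sum is the coefficient of degree deg P - 1 of the interpolant, which is zero because M < deg
-- P - 1.
theorem sum_roots_pow_div_derivative {P : ℂ[X]}
    (hP : ∀ t, P.IsRoot t → P.derivative.eval t ≠ 0) {M : ℕ} (hM : M + 2 ≤ P.natDegree) :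
    ∑ t ∈ P.roots.toFinset, t ^ M / P.derivative.eval t = 0 := by
  classical
  have hP0 : P ≠ 0 := by rintro rfl; simp at hM
  have hnd : P.roots.Nodup := by
    rw [Multiset.nodup_iff_count_le_one]
    intro t
    rw [count_roots]
    by_contra! h
    obtain ⟨h1, h2⟩ := (one_lt_rootMultiplicity_iff_isRoot hP0).1 h
    exact hP t h1 h2
  set s := P.roots.toFinset with hs
  have hsplit := IsAlgClosed.splits P
  have hcard : s.card = P.natDegree := by
    rw [hs, Multiset.toFinset_card_of_nodup hnd, hsplit.natDegree_eq_card_roots]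
  have hfac : P = C P.leadingCoeff * Lagrange.nodal s id := by
    conv_lhs => rw [hsplit.eq_prod_roots]
    rw [Lagrange.nodal, Finset.prod, hs, Multiset.toFinset_val, hnd.dedup]
    rfl
  have hder : ∀ t ∈ s, P.derivative.eval t = P.leadingCoeff * ∏ u ∈ s.erase t, (t - u) := by
    intro t ht
    conv_lhs => rw [hfac]
    rw [derivative_C_mul, eval_mul, eval_C,
      show eval t (derivative (Lagrange.nodal s id)) = _ from
        Lagrange.eval_nodal_derivative_eval_node_eq (v := id) ht, Lagrange.eval_nodal]
    rfl
  have hL := Lagrange.coeff_eq_sum (s := s) (v := id) (Set.injOn_id _) (P := (X : ℂ[X]) ^ M)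
    (by rw [degree_X_pow, hcard]; exact_mod_cast (by omega : M < P.natDegree))
  rw [coeff_X_pow, if_neg (by omega)] at hL
  calc ∑ t ∈ s, t ^ M / P.derivative.eval t
      = ∑ t ∈ s, P.leadingCoeff⁻¹ * (t ^ M / ∏ u ∈ s.erase t, (t - u)) := by
        refine Finset.sum_congr rfl fun t ht => ?_
        rw [hder t ht, div_eq_mul_inv, mul_inv]
        ring
    _ = P.leadingCoeff⁻¹ * 0 := by
        rw [← Finset.mul_sum]
        congr 1
        rw [hL]
        simp
    _ = 0 := mul_zero _

/-- The residues of `t ^ m / ∏ (c_i t ^ n_i - 1) · dt / t` at the zeros of the denominator sum to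
zero if there is no residue at `0` and at `∞`. -/
theorem sum_residues_eq_zero {ι : Type*} [DecidableEq ι] (s : Finset ι) (n : ι → ℤ) (c : ι → ℂ)
    (hn : ∀ i ∈ s, n i ≠ 0) (hc : ∀ i ∈ s, c i ≠ 0) (m : ℤ)
    (hm0 : -∑ i ∈ s, (n i)⁻ < m) (hm1 : m < ∑ i ∈ s, (n i)⁺)
    (hdis : ∀ t : ℂ, t ≠ 0 → ∀ i ∈ s, ∀ j ∈ s, c i * t ^ n i = 1 → c j * t ^ n j = 1 → i = j) :
    ∃ R : Finset ℂ, (∀ t, t ∈ R ↔ t ≠ 0 ∧ ∃ i ∈ s, c i * t ^ n i = 1) ∧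
      ∀ (C : ℂ) (g : ℂ → ℂ), (∀ t ∈ R, ∀ i ∈ s, c i * t ^ n i = 1 →
        g t = C * (t ^ m / (n i * ∏ j ∈ s.erase i, (c j * t ^ n j - 1)))) →
          ∑ t ∈ R, g t = 0 := by
  open Polynomial in
  let e : ι → ℕ := fun i => (n i).toNat
  let a : ι → ℕ := fun i => (-n i).toNat
  have hea : ∀ i, (e i : ℤ) - a i = n i := fun i => by simp only [e, a]; omega
  have hePos : ∀ i, (e i : ℤ) = (n i)⁺ := fun i => by simp [e, posPart_def]
  have haNeg : ∀ i, (a i : ℤ) = (n i)⁻ := fun i => by simp [a, negPart_def]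
  -- Denominators are cleared by t^(n_i⁻), giving a polynomial of degree |n_i| that does not vanish
  -- at 0.
  let F : ι → ℂ[X] := fun i => C (c i) * X ^ e i - X ^ a i
  have hFe : ∀ i, ∀ t : ℂ, t ≠ 0 → (F i).eval t = t ^ a i * (c i * t ^ n i - 1) := by
    intro i t ht
    have : t ^ (a i) * t ^ n i = t ^ e i := by
      rw [← zpow_natCast, ← zpow_natCast, ← zpow_add₀ ht, ← hea i]
      congr 1; ring
    simp only [F, eval_sub, eval_mul, eval_C, eval_pow, eval_X]
    rw [← this]; ring
  have hF0 : ∀ i ∈ s, (F i).eval 0 ≠ 0 := by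
    intro i hi
    have := hn i hi
    have := hc i hi
    rcases lt_or_gt_of_ne (hn i hi) with h | h
    · have h1 : e i = 0 := by simp only [e]; omega
      have h2 : a i ≠ 0 := by simp only [a]; omega
      simpa [F, h1, h2]
    · have h1 : e i ≠ 0 := by simp only [e]; omega
      have h2 : a i = 0 := by simp only [a]; omega
      simp [F, h1, h2]
  have hFne : ∀ i ∈ s, F i ≠ 0 := fun i hi h => hF0 i hi (by simp [h])
  have hFdeg : ∀ i ∈ s, (F i).natDegree = e i + a i := by
    intro i hi
    have := hc i hi
    rcases lt_or_gt_of_ne (hn i hi) with h | h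
    · have h1 : e i = 0 := by simp only [e]; omega
      have h2 : a i ≠ 0 := by simp only [a]; omega
      simp only [F, h1, pow_zero, mul_one, zero_add]
      rw [natDegree_sub, natDegree_sub_C, natDegree_X_pow]
    · have h1 : e i ≠ 0 := by simp only [e]; omega
      have h2 : a i = 0 := by simp only [a]; omega
      simp only [F, h2, pow_zero, add_zero]
      rw [← C_1, natDegree_sub_C, natDegree_C_mul_X_pow _ _ this]
  set P := ∏ i ∈ s, F i with hPdef
  have hPne : P ≠ 0 := Finset.prod_ne_zero_iff.2 hFne
  have hPdeg : P.natDegree = ∑ i ∈ s, (e i + a i) := by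
    rw [hPdef, natDegree_prod _ _ hFne]
    exact Finset.sum_congr rfl hFdeg
  have hroot : ∀ t, P.IsRoot t ↔ t ≠ 0 ∧ ∃ i ∈ s, c i * t ^ n i = 1 := by
    intro t
    rw [IsRoot, hPdef, eval_prod, Finset.prod_eq_zero_iff]
    constructor
    · rintro ⟨i, hi, h⟩
      have ht : t ≠ 0 := by rintro rfl; exact hF0 i hi h
      rw [hFe i t ht, mul_eq_zero, or_iff_right (pow_ne_zero _ ht), sub_eq_zero] at h
      exact ⟨ht, i, hi, h⟩
    · rintro ⟨ht, i, hi, h⟩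
      exact ⟨i, hi, by rw [hFe i t ht, h, sub_self, mul_zero]⟩
  have hder : ∀ t : ℂ, t ≠ 0 → ∀ i ∈ s, c i * t ^ n i = 1 →
      t * P.derivative.eval t =
        t ^ (∑ j ∈ s, a j) * (n i * ∏ j ∈ s.erase i, (c j * t ^ n j - 1)) := by
    intro t ht i hi h
    have h1 : (F i).eval t = 0 := by rw [hFe i t ht, h, sub_self, mul_zero]
    have h2 : t * (F i).derivative.eval t = t ^ a i * n i := by
      have hd : ∀ k : ℕ, t * (k * t ^ (k - 1)) = k * t ^ k := by
        intro k
        rcases k with _ | k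
        · simp
        · simp [pow_succ]; ring
      have h3 : c i * t ^ e i = t ^ a i := by
        have := h1
        simp only [F, eval_sub, eval_mul, eval_C, eval_pow, eval_X] at this
        exact sub_eq_zero.1 this
      simp only [F, derivative_sub, derivative_C_mul, derivative_X_pow, eval_sub, eval_mul,
        eval_C, eval_pow, eval_X]
      rw [mul_sub, mul_left_comm, hd, hd, mul_left_comm, h3, ← hea i]
      push_cast; ring
    rw [hPdef, ← Finset.mul_prod_erase s F hi, derivative_mul, eval_add, eval_mul, eval_mul, h1,
      zero_mul, add_zero, ← mul_assoc, h2, eval_prod,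
      Finset.prod_congr rfl fun j _ => hFe j t ht, Finset.prod_mul_distrib,
      Finset.prod_pow_eq_pow_sum, ← Finset.add_sum_erase s a hi, pow_add]
    ring
  have hsimple : ∀ t, P.IsRoot t → P.derivative.eval t ≠ 0 := by
    intro t hr h0
    obtain ⟨ht, i, hi, h⟩ := (hroot t).1 hr
    have := hder t ht i hi h
    rw [h0, mul_zero, eq_comm, mul_eq_zero, mul_eq_zero, Finset.prod_eq_zero_iff] at this
    rcases this with h' | h' | ⟨j, hj, h'⟩
    · exact pow_ne_zero _ ht h'
    · exact hn i hi (by exact_mod_cast h')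
    · rw [Finset.mem_erase] at hj
      exact hj.1 (hdis t ht i hi j hj.2 h (sub_eq_zero.1 h')).symm
  have hA : ((∑ i ∈ s, a i : ℕ) : ℤ) = ∑ i ∈ s, (n i)⁻ := by push_cast; simp [haNeg]
  have hE : ((∑ i ∈ s, e i : ℕ) : ℤ) = ∑ i ∈ s, (n i)⁺ := by push_cast; simp [hePos]
  -- The -1 comes from dt/t. The lower bound on `m` makes this exponent nonnegative (no pole at 0);
  -- the upper bound gives M + 2 ≤ deg P (no pole at ∞).
  obtain ⟨M, hM⟩ : ∃ M : ℕ, (M : ℤ) + 1 = m + (∑ i ∈ s, a i : ℕ) :=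
    ⟨(m + (∑ i ∈ s, a i : ℕ) - 1).toNat, by omega⟩
  have hsum := sum_roots_pow_div_derivative hsimple (M := M)
    (by rw [hPdeg, Finset.sum_add_distrib]; omega)
  have hmem : ∀ t, t ∈ P.roots.toFinset ↔ t ≠ 0 ∧ ∃ i ∈ s, c i * t ^ n i = 1 := fun t => by
    rw [Multiset.mem_toFinset, mem_roots hPne, hroot]
  refine ⟨P.roots.toFinset, hmem, fun C g hg => ?_⟩
  rw [← mul_zero C, ← hsum, Finset.mul_sum]
  refine Finset.sum_congr rfl fun t ht => ?_
  obtain ⟨ht0, i, hi, h⟩ := (hmem t).1 ht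
  have hPr : P.IsRoot t := (hroot t).2 ⟨ht0, i, hi, h⟩
  have hd := hder t ht0 i hi h
  have hd0 : t * P.derivative.eval t ≠ 0 := mul_ne_zero ht0 (hsimple t hPr)
  have hp : t ^ (M + 1) = t ^ m * t ^ (∑ j ∈ s, a j) := by
    rw [← zpow_natCast, ← zpow_natCast, ← zpow_add₀ ht0, ← hM]
    push_cast; rfl
  rw [hg t ht i hi h]
  congr 1
  rw [div_eq_div_iff ?_ (hsimple t hPr)]
  · rw [← mul_right_inj' (mul_ne_zero ht0 (pow_ne_zero (∑ j ∈ s, a j) ht0))]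
    calc _ = (t ^ m * t ^ (∑ j ∈ s, a j)) * (t * P.derivative.eval t) := by ring
      _ = _ := by rw [← hp, hd]; ring
  · intro h0
    rw [hd, h0, mul_zero] at hd0
    exact hd0 rfl

/-! ### Gale duality and total non-resonance -/

theorem sum_orderEmbOfFin {M : Type*} [AddCommMonoid M] {J : Finset (Fin N)} {m : ℕ}
    (hJ : J.card = m) {f : Fin N → M} (hf : ∀ i ∉ J, f i = 0) :
    ∑ a, f (J.orderEmbOfFin hJ a) = ∑ i, f i := by
  have h := Finset.sum_map Finset.univ (J.orderEmbOfFin hJ).toEmbedding f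
  rw [Finset.map_orderEmbOfFin_univ,
    Finset.sum_subset (Finset.subset_univ J) fun i _ hi => hf i hi] at h
  exact h.symm

/-- Gale duality: the complement of a cotriangle indexes linearly independent columns of `A`. -/
theorem IsCotriangle.linearIndependent_compl (hN : N = r + d) {A : Matrix (Fin r) (Fin N) ℤ}
    {B : Matrix (Fin d) (Fin N) ℤ} (hB : IsGaleDual A B) {I : Finset (Fin N)}
    (hI : IsCotriangle B I) : LinearIndependent ℝ (fun j : (Iᶜ : Finset (Fin N)) => realCol A j) := by
  classical
  have hcard : Iᶜ.card = r := by
    rw [Finset.card_compl, Fintype.card_fin, hI.1]; omega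
  set e := Iᶜ.orderEmbOfFin hcard with he
  -- The argument runs over ℤ, because a relation must be integral to be a combination of the rows
  -- of `B`. A relation supported off `I` is a linear form on the columns of `B` that vanishes on
  -- the basis `I`, hence is zero.
  have hdet : (A.submatrix id e).det ≠ 0 := by
    intro h0
    obtain ⟨v, hv, hMv⟩ := Matrix.exists_mulVec_eq_zero_iff.2 h0
    set l : Fin N → ℤ := Function.extend e v 0 with hl
    have hle : ∀ a, l (e a) = v a := fun a => e.injective.extend_apply v 0 a
    have hlI : ∀ i ∉ Iᶜ, l i = 0 := fun i hi => by
      rw [hl, Function.extend_apply' _ _ _ ?_, Pi.zero_apply]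
      rintro ⟨a, rfl⟩
      exact hi (Finset.orderEmbOfFin_mem _ hcard a)
    have hlA : l ∈ relationLattice A := by
      rw [relationLattice, LinearMap.mem_ker, Matrix.mulVecLin_apply, ← hMv]
      funext k
      rw [Matrix.mulVec, dotProduct, Matrix.mulVec, dotProduct,
        ← sum_orderEmbOfFin hcard (f := fun i => A k i * l i) fun i hi => by simp [hlI i hi]]
      exact Finset.sum_congr rfl fun a _ => by rw [← he, hle]; rfl
    rw [← hB.span_eq, Submodule.mem_span_range_iff_exists_fun] at hlA
    obtain ⟨n, hn⟩ := hlA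
    let φ : (Fin d → ℝ) →ₗ[ℝ] ℝ := ∑ k, (n k : ℝ) • LinearMap.proj k
    have hφ : ∀ i, φ (realCol B i) = l i := fun i => by
      rw [← hn]
      simp [φ, realCol]
    have hφ0 : φ = 0 := hI.linearMap_ext fun i hi => by
      rw [hφ, hlI i (by simpa using hi)]; simp
    refine hv (funext fun a => ?_)
    have := hφ (e a)
    rw [hφ0, hle] at this
    simpa using this.symm
  rw [linearIndependent_iff_sum]
  intro c hc hs
  have hdetR : ((A.submatrix id e).map (Int.cast : ℤ → ℝ)).det ≠ 0 := by
    have := Int.cast_det (R := ℝ) (A.submatrix id e)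
    rw [← this]
    exact_mod_cast hdet
  have hce : (fun a => c (e a)) = 0 := by
    by_contra hne
    refine hdetR (Matrix.exists_mulVec_eq_zero_iff.1 ⟨_, hne, ?_⟩)
    funext k
    have h1 := congrFun hs k
    rw [Finset.sum_apply, ← sum_orderEmbOfFin hcard
      (f := fun i => (c i • realCol A i) k) fun i hi => by simp [hc i hi]] at h1
    simpa [Matrix.mulVec, dotProduct, realCol, mul_comm] using h1
  funext i
  by_cases hi : i ∈ Iᶜ
  · have : i ∈ Set.range e := by
      rw [he, Finset.range_orderEmbOfFin]; exact hi
    obtain ⟨a, rfl⟩ := this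
    exact congrFun hce a
  · exact hc i hi

theorem mulVec_gammaShift {A : Matrix (Fin r) (Fin N) ℤ} {B : Matrix (Fin d) (Fin N) ℤ}
    (hB : IsGaleDual A B) (γ₀ : Fin N → ℝ) (μ : Fin d → ℝ) (k : Fin r) :
    ∑ i, (A k i : ℝ) * gammaShift B γ₀ μ i = (A.map (Int.cast : ℤ → ℝ) *ᵥ γ₀) k := by
  have hrow : ∀ l : Fin d, ∑ i, A k i * B l i = 0 := fun l => by
    have : B l ∈ relationLattice A := hB.span_eq ▸ Submodule.subset_span ⟨l, rfl⟩
    exact congrFun (LinearMap.mem_ker.1 this) k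
  have hrow' : ∀ l : Fin d, ∑ i, (A k i : ℝ) * B l i = 0 := fun l => by exact_mod_cast hrow l
  simp only [gammaShift, mul_add, Finset.sum_add_distrib, Finset.mul_sum]
  rw [Finset.sum_comm]
  have : ∀ l : Fin d, ∑ i, (A k i : ℝ) * (μ l * B l i) = 0 := fun l => by
    simp only [mul_left_comm _ (μ l), ← Finset.mul_sum, hrow', mul_zero]
  simp [this, Matrix.mulVec, dotProduct]

/-- Total non-resonance makes the cotriangle of a solution point unique. -/
theorem IsCotriangleAt.unique (hN : N = r + d) {A : Matrix (Fin r) (Fin N) ℤ}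
    {B : Matrix (Fin d) (Fin N) ℤ} (hB : IsGaleDual A B) {γ₀ : Fin N → ℝ}
    (hα : IsTotallyNonresonant A ((A.map (Int.cast : ℤ → ℝ)) *ᵥ γ₀)) {μ : Fin d → ℝ}
    {I I' : Finset (Fin N)} (hI : IsCotriangleAt B γ₀ μ I) (hI' : IsCotriangleAt B γ₀ μ I') :
    I = I' := by
  classical
  by_contra hne
  obtain ⟨j, hj, hjI⟩ : ∃ j ∈ I', j ∉ I := by
    by_contra! h
    exact hne (Finset.eq_of_subset_of_card_le h (by rw [hI.1.1, hI'.1.1])).symm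
  have hcard : Iᶜ.card = r := by
    rw [Finset.card_compl, Fintype.card_fin, hI.1.1]; omega
  have hjc : j ∈ Iᶜ := Finset.mem_compl.2 hjI
  have hind : LinearIndependent ℝ (fun i : (Iᶜ.erase j : Finset (Fin N)) => realCol A i) := by
    have h1 : LinearIndepOn ℝ (realCol A) ((Iᶜ : Finset (Fin N)) : Set (Fin N)) :=
      hI.1.linearIndependent_compl hN hB
    exact h1.mono (Finset.coe_subset.2 (Finset.erase_subset j Iᶜ))
  -- The fractional parts of γ^μ vanish on `I` and at `j`, so they place an integer translate of α
  -- in a cone on r - 1 independent columns.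
  refine hα (Iᶜ.erase j) (by rw [Finset.card_erase_add_one hjc, hcard]) hind
    (fun k => -∑ i, A k i * ⌊gammaShift B γ₀ μ i⌋) ?_
  refine mem_colCone_iff.2 ⟨fun i => Int.fract (gammaShift B γ₀ μ i),
    fun i => Int.fract_nonneg _, fun i hi => ?_, ?_⟩
  · have : ∃ m : ℤ, gammaShift B γ₀ μ i = m := by
      by_cases hij : i = j
      · exact hij ▸ hI'.2 j hj
      · refine hI.2 i ?_
        by_contra h
        exact hi (Finset.mem_erase.2 ⟨hij, Finset.mem_compl.2 h⟩)
    obtain ⟨m, hm⟩ := this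
    simp only [hm, Int.fract_intCast]
  · funext k
    rw [← mulVec_gammaShift hB γ₀ μ k]
    simp only [Finset.sum_apply, Pi.smul_apply, realCol, smul_eq_mul, Int.fract]
    push_cast
    rw [← sub_eq_add_neg, ← Finset.sum_sub_distrib]
    exact Finset.sum_congr rfl fun i _ => by ring

theorem solutionCotriangle_eq (hN : N = r + d) {A : Matrix (Fin r) (Fin N) ℤ}
    {B : Matrix (Fin d) (Fin N) ℤ} (hB : IsGaleDual A B) {γ₀ : Fin N → ℝ}
    (hα : IsTotallyNonresonant A ((A.map (Int.cast : ℤ → ℝ)) *ᵥ γ₀)) {μ : Fin d → ℝ}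
    {I : Finset (Fin N)} (hI : IsCotriangleAt B γ₀ μ I) : solutionCotriangle B γ₀ μ = I := by
  have h : ∃ I, IsCotriangleAt B γ₀ μ I := ⟨I, hI⟩
  rw [solutionCotriangle, dif_pos h]
  exact IsCotriangleAt.unique hN hB hα h.choose_spec hI

theorem IsSolutionPoint.isCotriangleAt {B : Matrix (Fin d) (Fin N) ℤ} {γ₀ : Fin N → ℝ}
    {μ : Fin d → ℝ} (h : IsSolutionPoint B γ₀ μ) :
    IsCotriangleAt B γ₀ μ (solutionCotriangle B γ₀ μ) := by
  rw [solutionCotriangle, dif_pos h.2]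
  exact h.2.choose_spec

/-- For a fixed cotriangle `I`, the integers γ^μ_i, i ∈ I, determine μ because the columns form a
basis, and they are bounded because μ lies in the unit cube. -/
theorem finite_solutionPoints (B : Matrix (Fin d) (Fin N) ℤ) (γ₀ : Fin N → ℝ)
    (S : Set (Finset (Fin N))) : (solutionPoints B γ₀ S).Finite := by
  have hsub : solutionPoints B γ₀ S ⊆
      ⋃ I ∈ {I : Finset (Fin N) | IsCotriangle B I},
        {μ | (∀ k, 0 ≤ μ k ∧ μ k < 1) ∧ ∀ i ∈ I, ∃ m : ℤ, gammaShift B γ₀ μ i = m} := by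
    rintro μ ⟨h, -⟩
    exact Set.mem_biUnion (x := solutionCotriangle B γ₀ μ) h.isCotriangleAt.1
      ⟨h.1, h.isCotriangleAt.2⟩
  refine (Set.Finite.biUnion (Set.toFinite _) fun I hI => ?_).subset hsub
  have hI : IsCotriangle B I := hI
  set C : Fin N → ℤ := fun i => ⌈|γ₀ i| + ∑ k, |(B k i : ℝ)|⌉ with hC
  refine Set.Finite.of_finite_image (f := fun μ (i : I) => ⌊gammaShift B γ₀ μ i⌋)
    ((Set.Finite.pi' fun i : I => Set.finite_Icc (-C i) (C i)).subset ?_) ?_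
  · rintro _ ⟨μ, ⟨hμ, hint⟩, rfl⟩ i
    obtain ⟨m, hm⟩ := hint i i.2
    have hb : |gammaShift B γ₀ μ i| ≤ C i := by
      refine (abs_add_le _ _).trans (le_trans (add_le_add_right ?_ _) (Int.le_ceil _))
      refine (Finset.abs_sum_le_sum_abs _ _).trans (Finset.sum_le_sum fun k _ => ?_)
      rw [abs_mul, abs_of_nonneg (hμ k).1]
      exact mul_le_of_le_one_left (abs_nonneg _) (hμ k).2.le
    simp only [hm, Int.floor_intCast]
    rw [hm] at hb
    have h2 : |m| ≤ C i := by exact_mod_cast hb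
    exact abs_le.1 h2
  · rintro μ ⟨-, hμ⟩ ν ⟨-, hν⟩ heq
    let φ : (Fin d → ℝ) →ₗ[ℝ] ℝ := ∑ k, (μ k - ν k) • LinearMap.proj k
    have hφ : φ = 0 := hI.linearMap_ext fun i hi => by
      have h1 := congrFun heq ⟨i, hi⟩
      obtain ⟨m, hm⟩ := hμ i hi
      obtain ⟨n, hn⟩ := hν i hi
      simp only [hm, hn, Int.floor_intCast] at h1
      rw [h1, ← hn] at hm
      simp only [gammaShift, add_right_inj] at hm
      simp [φ, realCol, sub_mul, Finset.sum_sub_distrib, hm]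
    funext k
    have := LinearMap.congr_fun hφ (Pi.single k 1)
    simp [φ, Pi.single_apply] at this
    linarith

/-! ### Torus points and the value of the residue -/

theorem prod_zpow_eq_zpow_sum {ι : Type*} (s : Finset ι) (f : ι → ℤ) {t : ℂ} (ht : t ≠ 0) :
    ∏ k ∈ s, t ^ f k = t ^ ∑ k ∈ s, f k := by
  classical
  induction s using Finset.induction_on with
  | empty => simp
  | insert a s ha ih => rw [Finset.prod_insert ha, Finset.sum_insert ha, ih, zpow_add₀ ht]

theorem monomialAt_mul (b : Fin d → ℤ) (z w : Fin d → ℂ) :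
    monomialAt b (fun k => z k * w k) = monomialAt b z * monomialAt b w := by
  simp only [monomialAt, mul_zpow, Finset.prod_mul_distrib]

theorem monomialAt_zpow (b h : Fin d → ℤ) {t : ℂ} (ht : t ≠ 0) :
    monomialAt b (fun k => t ^ h k) = t ^ ∑ k, h k * b k := by
  simp only [monomialAt, ← zpow_mul]
  exact prod_zpow_eq_zpow_sum _ _ ht

theorem norm_monomialAt (b : Fin d → ℤ) {z : Fin d → ℂ} (hz : ∀ k, ‖z k‖ = 1) :
    ‖monomialAt b z‖ = 1 := by
  simp [monomialAt, norm_prod, hz]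

theorem norm_zetaPoint (μ : Fin d → ℝ) (k : Fin d) : ‖zetaPoint μ k‖ = 1 := by
  rw [zetaPoint, Complex.norm_exp]
  simp

theorem monomialAt_zetaPoint (b : Fin d → ℤ) (μ : Fin d → ℝ) :
    monomialAt b (zetaPoint μ) =
      Complex.exp (2 * Real.pi * Complex.I * ((∑ k, μ k * b k : ℝ) : ℂ)) := by
  simp only [monomialAt, zetaPoint, ← Complex.exp_int_mul, ← Complex.exp_sum]
  congr 1
  push_cast
  rw [Finset.mul_sum]
  exact Finset.sum_congr rfl fun k _ => by ring

theorem binomialFactor_zetaPoint (B : Matrix (Fin d) (Fin N) ℤ) (γ₀ : Fin N → ℝ) (i : Fin N)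
    (μ : Fin d → ℝ) : binomialFactor B γ₀ i (zetaPoint μ) =
      Complex.exp (2 * Real.pi * Complex.I * (gammaShift B γ₀ μ i : ℂ)) - 1 := by
  rw [binomialFactor, monomialAt_zetaPoint, ← Complex.exp_add, gammaShift]
  congr 2
  push_cast
  ring

theorem exp_two_pi_mul_eq_one_iff (x : ℝ) :
    Complex.exp (2 * Real.pi * Complex.I * (x : ℂ)) = 1 ↔ ∃ m : ℤ, x = m := by
  rw [Complex.exp_eq_one_iff]
  refine exists_congr fun m => ?_
  have h : (2 * Real.pi * Complex.I : ℂ) ≠ 0 := Complex.two_pi_I_ne_zero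
  rw [mul_comm (m : ℂ), mul_right_inj' h]
  exact_mod_cast Iff.rfl

theorem binomialFactor_zetaPoint_eq_zero_iff (B : Matrix (Fin d) (Fin N) ℤ) (γ₀ : Fin N → ℝ)
    (i : Fin N) (μ : Fin d → ℝ) :
    binomialFactor B γ₀ i (zetaPoint μ) = 0 ↔ ∃ m : ℤ, gammaShift B γ₀ μ i = m := by
  rw [binomialFactor_zetaPoint, sub_eq_zero, exp_two_pi_mul_eq_one_iff]

theorem zetaPoint_injOn : Set.InjOn (zetaPoint (d := d)) {μ | ∀ k, 0 ≤ μ k ∧ μ k < 1} := by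
  intro μ hμ ν hν h
  funext k
  have h1 : Complex.exp (2 * Real.pi * Complex.I * ((μ k - ν k : ℝ) : ℂ)) = 1 := by
    have := congrFun h k
    simp only [zetaPoint] at this
    push_cast
    rw [mul_sub, Complex.exp_sub, this, div_self (Complex.exp_ne_zero _)]
  obtain ⟨m, hm⟩ := (exp_two_pi_mul_eq_one_iff _).1 h1
  have h2 : (m : ℝ) < 1 := by linarith [(hμ k).2, (hν k).1]
  have h3 : (-1 : ℝ) < m := by linarith [(hμ k).1, (hν k).2]
  have h4 : m < 1 := by exact_mod_cast h2
  have h5 : -1 < m := by exact_mod_cast h3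
  obtain rfl : m = 0 := by omega
  simp at hm
  linarith

theorem exists_zetaPoint_eq {z : Fin d → ℂ} (hz : ∀ k, ‖z k‖ = 1) :
    ∃ μ : Fin d → ℝ, (∀ k, 0 ≤ μ k ∧ μ k < 1) ∧ zetaPoint μ = z := by
  refine ⟨fun k => Int.fract ((z k).arg / (2 * Real.pi)),
    fun k => ⟨Int.fract_nonneg _, Int.fract_lt_one _⟩, funext fun k => ?_⟩
  have h1 : (2 * Real.pi * Complex.I * ((Int.fract ((z k).arg / (2 * Real.pi)) : ℝ) : ℂ)) =
      (z k).arg * Complex.I - (⌊(z k).arg / (2 * Real.pi)⌋ : ℤ) * (2 * Real.pi * Complex.I) := by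
    rw [Int.fract]
    push_cast
    have : (Real.pi : ℂ) ≠ 0 := by exact_mod_cast Real.pi_ne_zero
    field_simp
  have h2 := Complex.norm_mul_exp_arg_mul_I (z k)
  rw [hz k, Complex.ofReal_one, one_mul] at h2
  rw [zetaPoint, h1, Complex.exp_sub, Complex.exp_int_mul_two_pi_mul_I, div_one, h2]

/-- The logarithmic derivative gives B_ki (f_i + 1), and f_i = 0 here. Hence the Jacobian at a
common zero is just det B_I. -/
theorem zpow_mul_deriv_binomialFactor (B : Matrix (Fin d) (Fin N) ℤ) (γ₀ : Fin N → ℝ)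
    (i : Fin N) {z : Fin d → ℂ} (hz : ∀ k, z k ≠ 0) (hi : binomialFactor B γ₀ i z = 0)
    (k : Fin d) :
    z k * deriv (fun t : ℂ => binomialFactor B γ₀ i (Function.update z k t)) (z k) = B k i := by
  have hfun : (fun t : ℂ => binomialFactor B γ₀ i (Function.update z k t)) = fun t =>
      (Complex.exp (2 * Real.pi * Complex.I * (γ₀ i : ℂ)) *
        ∏ l ∈ Finset.univ.erase k, z l ^ B l i) * t ^ B k i - 1 := by
    funext t
    rw [binomialFactor, monomialAt, ← Finset.mul_prod_erase _ _ (Finset.mem_univ k),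
      Function.update_self]
    have : ∏ l ∈ Finset.univ.erase k, Function.update z k t l ^ B l i =
        ∏ l ∈ Finset.univ.erase k, z l ^ B l i :=
      Finset.prod_congr rfl fun l hl => by rw [Function.update_of_ne (Finset.ne_of_mem_erase hl)]
    rw [this]
    ring
  rw [binomialFactor, monomialAt, ← Finset.mul_prod_erase _ _ (Finset.mem_univ k)] at hi
  rw [hfun, ((hasDerivAt_zpow (B k i) (z k) (Or.inl (hz k))).const_mul _ |>.sub_const 1).deriv,
    zpow_sub_one₀ (hz k)]
  have := hz k
  field_simp
  linear_combination (B k i : ℂ) * hi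

theorem residueAt_eq {B : Matrix (Fin d) (Fin N) ℤ} {γ₀ : Fin N → ℝ} (τ : Fin d → ℤ)
    {I : Finset (Fin N)} (h : I.card = d) {z : Fin d → ℂ} (hz : ∀ k, z k ≠ 0)
    (hI : ∀ i ∈ I, binomialFactor B γ₀ i z = 0) :
    residueAt B γ₀ τ I z = monomialAt τ z /
      (((|(subB B I h).det| : ℤ) : ℂ) * ∏ j ∈ Iᶜ, binomialFactor B γ₀ j z) := by
  have hJ : logJacobian B γ₀ I h z = ((subB B I h).det : ℂ) := by
    rw [logJacobian, Int.cast_det]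
    congr 1
    ext k c
    exact zpow_mul_deriv_binomialFactor B γ₀ _ hz (hI _ (Finset.orderEmbOfFin_mem I h c)) k
  rw [residueAt, dif_pos h, hJ]
  generalize (subB B I h).det = D
  rcases lt_trichotomy D 0 with hD | rfl | hD
  · rw [Int.sign_eq_neg_one_of_neg hD, abs_of_neg hD]
    push_cast
    rw [neg_mul, one_mul, neg_mul, div_neg]
  · simp
  · rw [Int.sign_eq_one_of_pos hD, abs_of_pos hD]
    simp

theorem abs_det_eq_of_range_eq {g g' : Fin d → Fin N} (hg : Function.Injective g)
    (hg' : Function.Injective g') (h : Set.range g = Set.range g') (v : Fin N → Fin d → ℝ) :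
    |(Matrix.of fun c => v (g c)).det| = |(Matrix.of fun c => v (g' c)).det| := by
  let σ : Fin d ≃ Fin d :=
    (Equiv.ofInjective g' hg').trans ((Equiv.setCongr h.symm).trans (Equiv.ofInjective g hg).symm)
  have hσ : ∀ c, g (σ c) = g' c := fun c => by
    simp only [σ, Equiv.trans_apply]
    rw [Equiv.apply_ofInjective_symm hg]
    rfl
  rw [← Matrix.abs_det_submatrix_equiv_equiv σ (Equiv.refl _) (Matrix.of fun c => v (g c))]
  congr 2
  ext c k
  simp [hσ]

/-- The absolute determinants of the cotriangles containing a fixed facet `K` are proportional to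
the values on the extra column of a linear form vanishing on the facet. -/
theorem exists_abs_det_eq {B : Matrix (Fin d) (Fin N) ℤ} {φ : (Fin d → ℝ) →ₗ[ℝ] ℝ}
    {I₀ : Finset (Fin N)} (hI₀ : IsCotriangle B I₀) {i₀ : Fin N} (hi₀ : i₀ ∈ I₀)
    (hφ : φ (realCol B i₀) ≠ 0) (hK : ∀ k ∈ I₀.erase i₀, φ (realCol B k) = 0) :
    ∃ C : ℝ, ∀ i, i ∉ I₀.erase i₀ → ∀ h : (insert i (I₀.erase i₀)).card = d,
      ((|(subB B (insert i (I₀.erase i₀)) h).det| : ℤ) : ℝ) = C * |φ (realCol B i)| := by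
  classical
  set g := I₀.orderEmbOfFin hI₀.1 with hg
  have hgI : ∀ c, g c ∈ I₀ := fun c => Finset.orderEmbOfFin_mem _ _ _
  obtain ⟨p, hp⟩ : ∃ p, g p = i₀ := by
    have : i₀ ∈ Set.range g := by rw [hg, Finset.range_orderEmbOfFin]; exact hi₀
    exact this
  -- The determinant as a function of the column replacing `i₀` is a linear form vanishing on the
  -- facet, hence a multiple of `φ`. Inserting another index changes the increasing order, so the
  -- comparison is up to sign.
  let D : (Fin d → ℝ) →ₗ[ℝ] ℝ :=
    (Matrix.detRowAlternating (n := Fin d) (R := ℝ)).toMultilinearMap.toLinearMap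
      (fun c => realCol B (g c)) p
  have hD : ∀ x, D x = (Matrix.of (Function.update (fun c => realCol B (g c)) p x)).det :=
    fun x => rfl
  have hDφ : D = (D (realCol B i₀) / φ (realCol B i₀)) • φ := by
    refine hI₀.linearMap_ext fun i hi => ?_
    by_cases hii : i = i₀
    · rw [hii, LinearMap.smul_apply, smul_eq_mul, div_mul_cancel₀ _ hφ]
    · have hi' : i ∈ I₀.erase i₀ := Finset.mem_erase.2 ⟨hii, hi⟩
      rw [LinearMap.smul_apply, hK i hi', smul_zero, hD]
      obtain ⟨c, hc⟩ : ∃ c, g c = i := by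
        have : i ∈ Set.range g := by rw [hg, Finset.range_orderEmbOfFin]; exact hi
        exact this
      have hcp : c ≠ p := fun h => hii (by rw [← hc, h, hp])
      refine Matrix.det_zero_of_row_eq hcp ?_
      change Function.update (fun c => realCol B (g c)) p (realCol B i) c =
        Function.update (fun c => realCol B (g c)) p (realCol B i) p
      rw [Function.update_of_ne hcp, Function.update_self, hc]
  refine ⟨|D (realCol B i₀) / φ (realCol B i₀)|, fun i hi h => ?_⟩
  have h1 : |D (realCol B i)| =
      |D (realCol B i₀) / φ (realCol B i₀)| * |φ (realCol B i)| := by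
    conv_lhs => rw [hDφ]
    rw [LinearMap.smul_apply, smul_eq_mul, abs_mul]
  rw [← h1, hD]
  have hg'inj : Function.Injective (Function.update (g : Fin d → Fin N) p i) := by
    intro a b hab
    by_cases ha : a = p <;> by_cases hb : b = p
    · rw [ha, hb]
    · subst ha
      rw [Function.update_self, Function.update_of_ne hb] at hab
      refine absurd (Finset.mem_erase.2 ⟨?_, hgI b⟩) (hab ▸ hi)
      rw [← hp]; exact fun h => hb (g.injective h)
    · subst hb
      rw [Function.update_self, Function.update_of_ne ha] at hab
      refine absurd (Finset.mem_erase.2 ⟨?_, hgI a⟩) (hab ▸ hi)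
      rw [← hp]; exact fun h => ha (g.injective h)
    · rw [Function.update_of_ne ha, Function.update_of_ne hb] at hab
      exact g.injective hab
  have hrange : Set.range ((insert i (I₀.erase i₀)).orderEmbOfFin h) =
      Set.range (Function.update (g : Fin d → Fin N) p i) := by
    rw [Finset.range_orderEmbOfFin]
    ext j
    simp only [Finset.coe_insert, Set.mem_insert_iff, Finset.mem_coe, Finset.mem_erase,
      Set.mem_range]
    constructor
    · rintro (rfl | ⟨hj, hjI⟩)
      · exact ⟨p, Function.update_self ..⟩
      · have : j ∈ Set.range g := by rw [hg, Finset.range_orderEmbOfFin]; exact hjI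
        obtain ⟨c, rfl⟩ := this
        exact ⟨c, Function.update_of_ne (fun hc => hj (by rw [hc, hp])) _ _⟩
    · rintro ⟨c, rfl⟩
      by_cases hc : c = p
      · subst hc; left; exact Function.update_self ..
      · right
        rw [Function.update_of_ne hc]
        exact ⟨fun h => hc (g.injective (h.trans hp.symm)), hgI c⟩
  have h2 := abs_det_eq_of_range_eq ((insert i (I₀.erase i₀)).orderEmbOfFin h).injective
    hg'inj hrange (realCol B)
  have h3 : Function.update (fun c => realCol B (g c)) p (realCol B i) =
      fun c => realCol B (Function.update (g : Fin d → Fin N) p i c) := by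
    funext c
    by_cases hc : c = p
    · subst hc; simp
    · simp [hc]
  rw [h3, ← h2, ← Matrix.det_transpose, Int.cast_abs, Int.cast_det]
  rfl

/-! ### Residues along translated one-parameter subgroups -/

/-- The value of the integral linear form `h` on the `i`-th column of `B`. -/
def colPairing (B : Matrix (Fin d) (Fin N) ℤ) (h : Fin d → ℤ) (i : Fin N) : ℤ :=
  ∑ k, h k * B k i

/-- The real linear form with integer coefficients `h`. -/
def linForm (h : Fin d → ℤ) : (Fin d → ℝ) →ₗ[ℝ] ℝ :=
  ∑ k, (h k : ℝ) • LinearMap.proj k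

theorem linForm_apply (h : Fin d → ℤ) (x : Fin d → ℝ) : linForm h x = ∑ k, (h k : ℝ) * x k := by
  simp [linForm]

theorem linForm_realCol (B : Matrix (Fin d) (Fin N) ℤ) (h : Fin d → ℤ) (i : Fin N) :
    linForm h (realCol B i) = colPairing B h i := by
  simp [linForm_apply, colPairing, realCol]

/-- The cotriangles with a facet in `𝒦`, contained in the hyperplane `h = 0`, and with remaining
column on the positive side of that hyperplane. -/
def wallCotriangles (B : Matrix (Fin d) (Fin N) ℤ) (h : Fin d → ℤ) (𝒦 : Set (Finset (Fin N))) :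
    Set (Finset (Fin N)) :=
  {I | IsCotriangle B I ∧ ∃ i ∈ I, 0 < colPairing B h i ∧
    (∀ k ∈ I.erase i, colPairing B h k = 0) ∧ I.erase i ∈ 𝒦}

/-- The component of `z` along the subtorus `z ^ c = 1`, complementary to the one-parameter
subgroup `t ^ h` when `c · h = 1`. -/
def torusPart (c h : Fin d → ℤ) (z : Fin d → ℂ) : Fin d → ℂ :=
  fun k => z k * (monomialAt c z) ^ (-h k)

theorem monomialAt_ne_zero (b : Fin d → ℤ) {z : Fin d → ℂ} (hz : ∀ k, ‖z k‖ = 1) :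
    monomialAt b z ≠ 0 := by
  rw [← norm_ne_zero_iff, norm_monomialAt b hz]
  exact one_ne_zero

theorem norm_torusPart (c h : Fin d → ℤ) {z : Fin d → ℂ} (hz : ∀ k, ‖z k‖ = 1) (k : Fin d) :
    ‖torusPart c h z k‖ = 1 := by
  rw [torusPart, norm_mul, norm_zpow, hz, norm_monomialAt c hz]
  simp

theorem torusPart_mul_zpow (c h : Fin d → ℤ) {z : Fin d → ℂ} (hz : ∀ k, ‖z k‖ = 1) :
    (fun k => torusPart c h z k * (monomialAt c z) ^ h k) = z := by
  funext k
  rw [torusPart, mul_assoc, ← zpow_add₀ (monomialAt_ne_zero c hz)]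
  simp

theorem monomialAt_torusPart {c h : Fin d → ℤ} (hch : ∑ k, h k * c k = 1) {z : Fin d → ℂ}
    (hz : ∀ k, ‖z k‖ = 1) : monomialAt c (torusPart c h z) = 1 := by
  have h0 := monomialAt_ne_zero c hz
  have h1 := monomialAt_mul c (torusPart c h z) (fun k => (monomialAt c z) ^ h k)
  rw [torusPart_mul_zpow c h hz, monomialAt_zpow c h h0, hch, zpow_one] at h1
  exact mul_right_cancel₀ h0 (by rw [← h1, one_mul])

theorem monomialAt_mul_zpow {c h : Fin d → ℤ} (hch : ∑ k, h k * c k = 1) {w : Fin d → ℂ}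
    (hw : monomialAt c w = 1) {t : ℂ} (ht : t ≠ 0) :
    monomialAt c (fun k => w k * t ^ h k) = t := by
  rw [monomialAt_mul c w fun k => t ^ h k, monomialAt_zpow c h ht, hch, hw, zpow_one, one_mul]

theorem binomialFactor_mul_zpow (B : Matrix (Fin d) (Fin N) ℤ) (γ₀ : Fin N → ℝ) (h : Fin d → ℤ)
    (j : Fin N) (w : Fin d → ℂ) {t : ℂ} (ht : t ≠ 0) :
    binomialFactor B γ₀ j (fun k => w k * t ^ h k) =
      (Complex.exp (2 * Real.pi * Complex.I * (γ₀ j : ℂ)) * monomialAt (fun k => B k j) w) *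
        t ^ colPairing B h j - 1 := by
  rw [binomialFactor, monomialAt_mul _ w fun k => t ^ h k, monomialAt_zpow _ h ht, colPairing,
    ← mul_assoc (Complex.exp _)]

/-- Recovers the facet and the value on the extra column from the cotriangle and `n` alone, so that
points can be grouped and signed without choosing `i`. -/
theorem filter_eq_erase_of_facet {n : Fin N → ℤ} {I : Finset (Fin N)} {i : Fin N} (hi : i ∈ I)
    (hn : n i ≠ 0) (hK : ∀ k ∈ I.erase i, n k = 0) :
    I.filter (fun k => n k = 0) = I.erase i ∧ ∑ k ∈ I, n k = n i := by
  constructor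
  · ext k
    simp only [Finset.mem_filter, Finset.mem_erase]
    constructor
    · rintro ⟨hk, h0⟩
      exact ⟨fun h => hn (h ▸ h0), hk⟩
    · rintro ⟨hk, hkI⟩
      exact ⟨hkI, hK k (Finset.mem_erase.2 ⟨hk, hkI⟩)⟩
  · rw [← Finset.add_sum_erase I n hi, Finset.sum_eq_zero hK, add_zero]

theorem IsCotriangle.insert_facet {B : Matrix (Fin d) (Fin N) ℤ} {φ : (Fin d → ℝ) →ₗ[ℝ] ℝ}
    {I : Finset (Fin N)} (hI : IsCotriangle B I) {i : Fin N} (hi : i ∈ I)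
    (hK : ∀ k ∈ I.erase i, φ (realCol B k) = 0) {j : Fin N} (hj : φ (realCol B j) ≠ 0) :
    IsCotriangle B (insert j (I.erase i)) := by
  by_cases hjI : j ∈ I
  · have hji : j = i := by
      by_contra h
      exact hj (hK j (Finset.mem_erase.2 ⟨h, hjI⟩))
    rw [hji, Finset.insert_erase hi]
    exact hI
  · obtain ⟨β, hβ, hβs⟩ := hI.exists_sum_eq (realCol B j)
    refine hI.exchange hi hjI hβ hβs fun h0 => hj ?_
    rw [← hβs, map_sum]
    refine Finset.sum_eq_zero fun k _ => ?_
    by_cases hki : k = i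
    · simp [hki, h0]
    · by_cases hkI : k ∈ I
      · simp [hK k (Finset.mem_erase.2 ⟨hki, hkI⟩)]
      · simp [hβ k hkI]

/-- Places every zero on the compact torus, so that it comes from a real μ. -/
theorem norm_eq_one_of_mul_zpow_eq_one {a t : ℂ} (ha : ‖a‖ = 1) {n : ℤ} (hn : n ≠ 0)
    (h : a * t ^ n = 1) : ‖t‖ = 1 := by
  have h1 := congrArg norm h
  rw [norm_mul, ha, one_mul, norm_zpow, norm_one] at h1
  by_contra ht
  exact hn ((zpow_eq_one_iff_right₀ (norm_nonneg t) ht).1 h1)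

/-- The weight of a zonotope point on a line lies strictly between the orders at `0` and `∞`. -/
theorem openZonotope_pairing_lt {B : Matrix (Fin d) (Fin N) ℤ} {τ : Fin d → ℤ}
    (hτ : (fun k => (τ k : ℝ)) ∈ openZonotope B) {h : Fin d → ℤ} {i : Fin N}
    (hi : colPairing B h i ≠ 0) :
    -∑ j with colPairing B h j ≠ 0, (colPairing B h j)⁻ < ∑ k, h k * τ k ∧
      ∑ k, h k * τ k < ∑ j with colPairing B h j ≠ 0, (colPairing B h j)⁺ := by
  obtain ⟨ν, hν, hs⟩ := hτ
  have hm : ((∑ k, h k * τ k : ℤ) : ℝ) =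
      ∑ j with colPairing B h j ≠ 0, ν j * colPairing B h j := by
    have h1 : linForm h (fun k => (τ k : ℝ)) = ((∑ k, h k * τ k : ℤ) : ℝ) := by
      simp [linForm_apply]
    rw [← h1, hs, map_sum, Finset.sum_filter]
    refine Finset.sum_congr rfl fun j _ => ?_
    rw [map_smul, linForm_realCol, smul_eq_mul]
    split_ifs with h0
    · rfl
    · rw [not_not] at h0; simp [h0]
  have hne : (Finset.univ.filter fun j => colPairing B h j ≠ 0).Nonempty :=
    ⟨i, by simpa using hi⟩
  have hbound : ∀ j, colPairing B h j ≠ 0 →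
      -(((colPairing B h j)⁻ : ℤ) : ℝ) < ν j * colPairing B h j ∧
        ν j * colPairing B h j < (((colPairing B h j)⁺ : ℤ) : ℝ) := by
    intro j hj
    obtain ⟨h0, h1⟩ := hν j
    rcases lt_or_gt_of_ne hj with hj | hj
    · rw [negPart_of_nonpos hj.le, posPart_of_nonpos hj.le]
      have hj' : (colPairing B h j : ℝ) < 0 := by exact_mod_cast hj
      push_cast
      constructor <;> nlinarith
    · rw [negPart_of_nonneg hj.le, posPart_of_nonneg hj.le]
      have hj' : (0 : ℝ) < colPairing B h j := by exact_mod_cast hj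
      push_cast
      constructor <;> nlinarith
  constructor
  · rw [← Int.cast_lt (R := ℝ), hm, ← Finset.sum_neg_distrib]
    push_cast
    exact Finset.sum_lt_sum_of_nonempty hne fun j hj => (hbound j (Finset.mem_filter.1 hj).2).1
  · rw [← Int.cast_lt (R := ℝ), hm]
    push_cast
    exact Finset.sum_lt_sum_of_nonempty hne fun j hj => (hbound j (Finset.mem_filter.1 hj).2).2

/-- The residue at a point of a translated one-parameter subgroup, up to the sign of the extra
column, as a one-variable residue. -/
theorem signed_residue_eq {B : Matrix (Fin d) (Fin N) ℤ} {γ₀ : Fin N → ℝ} (τ : Fin d → ℤ)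
    {h : Fin d → ℤ} {w : Fin d → ℂ} {t : ℂ} (ht : t ≠ 0) {K : Finset (Fin N)} {i : Fin N}
    (hi : colPairing B h i ≠ 0) (hK : ∀ k ∈ K, colPairing B h k = 0) {μ : Fin d → ℝ}
    (hat : IsCotriangleAt B γ₀ μ (insert i K)) (hz : zetaPoint μ = fun k => w k * t ^ h k)
    (hI : solutionCotriangle B γ₀ μ = insert i K) {D : ℝ}
    (hD : ((|(subB B (insert i K) hat.1.1).det| : ℤ) : ℝ) = D * |linForm h (realCol B i)|) :
    ((∑ j ∈ solutionCotriangle B γ₀ μ, colPairing B h j).sign : ℂ) * omegaResidue B γ₀ τ μ =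
      monomialAt τ w / (D * ∏ j ∈ Finset.univ.filter (fun j => colPairing B h j = 0) \ K,
        (Complex.exp (2 * Real.pi * Complex.I * (γ₀ j : ℂ)) *
          monomialAt (fun k => B k j) w - 1)) *
      (t ^ (∑ k, h k * τ k) / (colPairing B h i *
        ∏ j ∈ (Finset.univ.filter (fun j => colPairing B h j ≠ 0)).erase i,
          (Complex.exp (2 * Real.pi * Complex.I * (γ₀ j : ℂ)) *
            monomialAt (fun k => B k j) w * t ^ colPairing B h j - 1))) := by
  classical
  have hf := fun j => binomialFactor_mul_zpow B γ₀ h j w ht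
  generalize hn : colPairing B h = n at *
  have hiK : i ∉ K := fun hiK => hi (hK i hiK)
  have hfac := filter_eq_erase_of_facet (n := n) (Finset.mem_insert_self i K) hi
    (by rw [Finset.erase_insert hiK]; exact hK)
  set Z := (Finset.univ.filter (fun j => n j = 0)) \ K with hZ
  set s := Finset.univ.filter (fun j => n j ≠ 0) with hs
  have hcompl : (insert i K)ᶜ = Z ∪ s.erase i := by
    ext j
    have := hK j
    simp only [Finset.mem_compl, Finset.mem_insert, hZ, hs, Finset.mem_union, Finset.mem_sdiff,
      Finset.mem_filter, Finset.mem_univ, true_and, Finset.mem_erase]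
    by_cases hj : n j = 0
    · have : j ≠ i := fun h => hi (h ▸ hj)
      tauto
    · tauto
  have hdisj : Disjoint Z (s.erase i) := by
    rw [Finset.disjoint_left]
    intro j hj hj'
    simp only [hZ, hs, Finset.mem_sdiff, Finset.mem_filter, Finset.mem_erase] at hj hj'
    exact hj'.2.2 hj.1.2
  have hdet := congrArg Complex.ofReal hD
  rw [linForm_realCol, Complex.ofReal_mul, Complex.ofReal_intCast, hn] at hdet
  have hZprod : ∏ j ∈ Z, binomialFactor B γ₀ j (fun k => w k * t ^ h k) =
      ∏ j ∈ Z, (Complex.exp (2 * Real.pi * Complex.I * (γ₀ j : ℂ)) *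
        monomialAt (fun k => B k j) w - 1) :=
    Finset.prod_congr rfl fun j hj => by
      have : n j = 0 := by
        simp only [hZ, Finset.mem_sdiff, Finset.mem_filter] at hj
        exact hj.1.2
      rw [hf, this, zpow_zero, mul_one]
  have hsprod := Finset.prod_congr (s₁ := s.erase i) rfl fun j _ => hf j
  have hsign : ((n i).sign : ℂ) / ((|(n i : ℝ)| : ℝ) : ℂ) = 1 / (n i : ℂ) := by
    rcases lt_or_gt_of_ne hi with hlt | hgt
    · rw [Int.sign_eq_neg_one_of_neg hlt, abs_of_neg (by exact_mod_cast hlt)]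
      push_cast
      rw [neg_div_neg_eq]
    · rw [Int.sign_eq_one_of_pos hgt, abs_of_pos (by exact_mod_cast hgt)]
      push_cast
      rfl
  rw [hI, hfac.2, omegaResidue, hI, residueAt_eq τ hat.1.1
    (fun k => by rw [← norm_ne_zero_iff, norm_zetaPoint]; exact one_ne_zero)
    (fun j hj => (binomialFactor_zetaPoint_eq_zero_iff B γ₀ j _).2 (hat.2 j hj)), hdet, hz,
    hcompl, Finset.prod_union hdisj, monomialAt_mul τ w fun k => t ^ h k, monomialAt_zpow τ h ht,
    hZprod, hsprod]
  -- The identity needs neither product to be nonzero, since inverses are multiplicative also with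
  -- 0⁻¹ = 0.
  generalize (∏ j ∈ Z, _ : ℂ) = p
  generalize (∏ j ∈ s.erase i, _ : ℂ) = q
  calc _ = (((n i).sign : ℂ) / ((|(n i : ℝ)| : ℝ) : ℂ)) *
        (monomialAt τ w * t ^ (∑ k, h k * τ k) / (D * (p * q))) := by
        simp only [div_eq_mul_inv, mul_inv]; ring
    _ = _ := by
        rw [hsign]
        simp only [div_eq_mul_inv, mul_inv]; ring

/-- The signed residues at the solution points on one translated one-parameter subgroup sum to
zero. -/
theorem sum_signed_residues_fiber_eq_zero (hN : N = r + d) {A : Matrix (Fin r) (Fin N) ℤ}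
    {B : Matrix (Fin d) (Fin N) ℤ} (hB : IsGaleDual A B) {γ₀ : Fin N → ℝ}
    (hα : IsTotallyNonresonant A ((A.map (Int.cast : ℤ → ℝ)) *ᵥ γ₀))
    {τ : Fin d → ℤ} (hτ : (fun k => (τ k : ℝ)) ∈ openZonotope B)
    {c h : Fin d → ℤ} (hch : ∑ k, h k * c k = 1) {𝒦 : Set (Finset (Fin N))}
    {S : Finset (Fin d → ℝ)}
    (hS : ∀ μ, μ ∈ S ↔ IsSolutionPoint B γ₀ μ ∧ ∃ i ∈ solutionCotriangle B γ₀ μ,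
      colPairing B h i ≠ 0 ∧
      (∀ k ∈ (solutionCotriangle B γ₀ μ).erase i, colPairing B h k = 0) ∧
      (solutionCotriangle B γ₀ μ).erase i ∈ 𝒦)
    {μ₀ : Fin d → ℝ} (hμ₀ : μ₀ ∈ S) :
    ∑ μ ∈ S with (solutionCotriangle B γ₀ μ).filter (fun k => colPairing B h k = 0) =
          (solutionCotriangle B γ₀ μ₀).filter (fun k => colPairing B h k = 0) ∧
        torusPart c h (zetaPoint μ) = torusPart c h (zetaPoint μ₀),
      ((∑ i ∈ solutionCotriangle B γ₀ μ, colPairing B h i).sign : ℂ) *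
        omegaResidue B γ₀ τ μ = 0 := by
  classical
  obtain ⟨hsol₀, i₀, hi₀, hn₀, hK₀, hK𝒦⟩ := (hS μ₀).1 hμ₀
  rw [(filter_eq_erase_of_facet hi₀ hn₀ hK₀).1]
  have hat₀ := hsol₀.isCotriangleAt
  set I₀ := solutionCotriangle B γ₀ μ₀
  set K := I₀.erase i₀ with hKdef
  set w := torusPart c h (zetaPoint μ₀) with hwdef
  set n := colPairing B h with hndef
  let a : Fin N → ℂ := fun j =>
    Complex.exp (2 * Real.pi * Complex.I * (γ₀ j : ℂ)) * monomialAt (fun k => B k j) w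
  have hw : ∀ k, ‖w k‖ = 1 := norm_torusPart c h (norm_zetaPoint μ₀)
  have hwc : monomialAt c w = 1 := monomialAt_torusPart hch (norm_zetaPoint μ₀)
  have ha : ∀ j, ‖a j‖ = 1 := fun j => by
    have := Complex.norm_exp (2 * Real.pi * Complex.I * (γ₀ j : ℂ))
    rw [norm_mul, norm_monomialAt _ hw, mul_one, this]
    simp
  have hf : ∀ j, ∀ t : ℂ, t ≠ 0 →
      binomialFactor B γ₀ j (fun k => w k * t ^ h k) = a j * t ^ n j - 1 :=
    fun j t ht => binomialFactor_mul_zpow B γ₀ h j w ht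
  have hφ : ∀ j, n j ≠ 0 → linForm h (realCol B j) ≠ 0 := fun j hj => by
    rw [linForm_realCol]; exact_mod_cast hj
  have hφK : ∀ k ∈ K, linForm h (realCol B k) = 0 := fun k hk => by
    rw [linForm_realCol]; exact_mod_cast hK₀ k hk
  have haK : ∀ k ∈ K, a k = 1 := fun k hk => by
    have h1 := (binomialFactor_zetaPoint_eq_zero_iff B γ₀ k μ₀).2
      (hat₀.2 k (Finset.mem_of_mem_erase hk))
    rw [← torusPart_mul_zpow c h (norm_zetaPoint μ₀), hf k _ (monomialAt_ne_zero c
      (norm_zetaPoint μ₀)), hK₀ k hk, zpow_zero, mul_one] at h1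
    exact sub_eq_zero.1 h1
  have hat : ∀ (μ : Fin d → ℝ) (t : ℂ) (i : Fin N), t ≠ 0 →
      zetaPoint μ = (fun k => w k * t ^ h k) → n i ≠ 0 → a i * t ^ n i = 1 →
      IsCotriangleAt B γ₀ μ (insert i K) := by
    intro μ t i ht hz hi h1
    refine ⟨hat₀.1.insert_facet hi₀ hφK (hφ i hi), fun j hj => ?_⟩
    rw [← binomialFactor_zetaPoint_eq_zero_iff, hz, hf j t ht, sub_eq_zero]
    rcases Finset.mem_insert.1 hj with rfl | hj
    · exact h1
    · rw [haK j hj, hK₀ j hj, zpow_zero, mul_one]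
  have hex : ∀ t : ℂ, ‖t‖ = 1 → ∃ μ : Fin d → ℝ, (∀ k, 0 ≤ μ k ∧ μ k < 1) ∧
      zetaPoint μ = (fun k => w k * t ^ h k) := fun t ht =>
    exists_zetaPoint_eq fun k => by rw [norm_mul, hw, norm_zpow, ht, one_zpow, one_mul]
  have hiK : ∀ i, n i ≠ 0 → i ∉ K := fun i hi hiK => hi (hK₀ i hiK)
  set s := Finset.univ.filter (fun j => n j ≠ 0) with hs
  have hmem_s : ∀ {j}, j ∈ s → n j ≠ 0 := fun hj => (Finset.mem_filter.1 hj).2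
  -- A common zero of factors `i` and `j` would be a solution point with the two cotriangles K ∪ {i}
  -- and K ∪ {j}.
  obtain ⟨R, hR, hsum⟩ := sum_residues_eq_zero s n a (fun i hi => hmem_s hi)
    (fun i _ => by rw [← norm_ne_zero_iff, ha]; exact one_ne_zero) (∑ k, h k * τ k)
    (openZonotope_pairing_lt hτ hn₀).1 (openZonotope_pairing_lt hτ hn₀).2 (by
      intro t ht i hi j hj h1 h2
      obtain ⟨μ, -, hz⟩ := hex t (norm_eq_one_of_mul_zpow_eq_one (ha i) (hmem_s hi) h1)
      have := IsCotriangleAt.unique hN hB hα (hat μ t i ht hz (hmem_s hi) h1)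
        (hat μ t j ht hz (hmem_s hj) h2)
      have hi' : i ∈ insert j K := this ▸ Finset.mem_insert_self i K
      exact (Finset.mem_insert.1 hi').resolve_right (hiK i (hmem_s hi)))
  have hpt : ∀ t ∈ R, ∃ μ : Fin d → ℝ, (∀ k, 0 ≤ μ k ∧ μ k < 1) ∧
      zetaPoint μ = (fun k => w k * t ^ h k) := fun t ht => by
    obtain ⟨-, i, hi, h1⟩ := (hR t).1 ht
    exact hex t (norm_eq_one_of_mul_zpow_eq_one (ha i) (hmem_s hi) h1)
  choose! m hmbox hmz using hpt
  have hmI : ∀ t ∈ R, ∀ i ∈ s, a i * t ^ n i = 1 →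
      solutionCotriangle B γ₀ (m t) = insert i K := fun t ht i hi h1 =>
    solutionCotriangle_eq hN hB hα (hat _ t i ((hR t).1 ht).1 (hmz t ht) (hmem_s hi) h1)
  have hmt : ∀ t ∈ R, monomialAt c (zetaPoint (m t)) = t := fun t ht => by
    rw [hmz t ht, monomialAt_mul_zpow hch hwc ((hR t).1 ht).1]
  obtain ⟨D, hD⟩ := exists_abs_det_eq hat₀.1 hi₀ (hφ i₀ hn₀) hφK
  rw [← hsum (monomialAt τ w / (D * ∏ j ∈ Finset.univ.filter (fun j => n j = 0) \ K, (a j - 1)))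
    (fun t => ((∑ i ∈ solutionCotriangle B γ₀ (m t), n i).sign : ℂ) *
        omegaResidue B γ₀ τ (m t)) ?_]
  · symm
    -- Zeros on the curve correspond to solution points in the fiber; the inverse is μ ↦ (ζ^μ)^c,
    -- because w^c = 1 and h · c = 1.
    refine Finset.sum_nbij m (fun t ht => ?_) (fun t ht t' ht' htt => ?_) (fun μ hμ => ?_)
      fun t _ => rfl
    · obtain ⟨ht0, i, hi, h1⟩ := (hR t).1 ht
      have hI := hmI t ht i hi h1
      have hins := Finset.erase_insert (hiK i (hmem_s hi))
      have hfac := filter_eq_erase_of_facet (n := n) (Finset.mem_insert_self i K) (hmem_s hi)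
        (by rw [hins]; exact hK₀)
      rw [Finset.mem_filter, hS, hI, hfac.1, hins]
      refine ⟨⟨⟨hmbox t ht, _, hat _ t i ht0 (hmz t ht) (hmem_s hi) h1⟩, i,
        Finset.mem_insert_self i K, hmem_s hi, ?_, ?_⟩, rfl, ?_⟩
      · rw [hins]; exact hK₀
      · rw [hins]; exact hK𝒦
      · funext k
        rw [torusPart, hmt t ht, hmz t ht, mul_assoc, ← zpow_add₀ ht0]
        simp
    · rw [← hmt t ht, ← hmt t' ht', htt]
    · rw [Finset.mem_coe, Finset.mem_filter, hS] at hμ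
      obtain ⟨⟨hsol, i, hi, hin, hiz, -⟩, hKμ, hwμ⟩ := hμ
      rw [(filter_eq_erase_of_facet hi hin hiz).1] at hKμ
      have hz := torusPart_mul_zpow c h (norm_zetaPoint μ)
      rw [hwμ] at hz
      have ht0 := monomialAt_ne_zero c (norm_zetaPoint μ)
      have h1 := (binomialFactor_zetaPoint_eq_zero_iff B γ₀ i μ).2 (hsol.isCotriangleAt.2 i hi)
      rw [← hz, hf i _ ht0, sub_eq_zero] at h1
      have hmem : monomialAt c (zetaPoint μ) ∈ R :=
        (hR _).2 ⟨ht0, i, by simpa [hs] using hin, h1⟩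
      exact ⟨_, hmem, zetaPoint_injOn (hmbox _ hmem) hsol.1 ((hmz _ hmem).trans hz)⟩
  · intro t ht i hi h1
    have ht0 := ((hR t).1 ht).1
    have hati := hat _ t i ht0 (hmz t ht) (hmem_s hi) h1
    exact signed_residue_eq τ ht0 (hmem_s hi) hK₀ hati (hmz t ht) (hmI t ht i hi h1)
      (hD i (hiK i (hmem_s hi)) hati.1.1)

/-! ### Comparison of the two sides of the wall -/

theorem colPairing_neg (B : Matrix (Fin d) (Fin N) ℤ) (h : Fin d → ℤ) (i : Fin N) :
    colPairing B (-h) i = -colPairing B h i := by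
  simp [colPairing]

theorem linForm_neg (h : Fin d → ℤ) : linForm (-h) = -linForm h := by
  ext
  simp [linForm]

/-- The residues at the solution points on the two sides of a hyperplane agree. -/
theorem finsum_residues_wallCotriangles_eq (hN : N = r + d) {A : Matrix (Fin r) (Fin N) ℤ}
    {B : Matrix (Fin d) (Fin N) ℤ} (hB : IsGaleDual A B) {γ₀ : Fin N → ℝ}
    (hα : IsTotallyNonresonant A ((A.map (Int.cast : ℤ → ℝ)) *ᵥ γ₀))
    {τ : Fin d → ℤ} (hτ : (fun k => (τ k : ℝ)) ∈ openZonotope B)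
    {c h : Fin d → ℤ} (hch : ∑ k, h k * c k = 1) (𝒦 : Set (Finset (Fin N))) :
    ∑ᶠ μ ∈ solutionPoints B γ₀ (wallCotriangles B h 𝒦), omegaResidue B γ₀ τ μ =
      ∑ᶠ μ ∈ solutionPoints B γ₀ (wallCotriangles B (-h) 𝒦), omegaResidue B γ₀ τ μ := by
  classical
  have hfin := finite_solutionPoints B γ₀ (wallCotriangles B h 𝒦)
  have hfin' := finite_solutionPoints B γ₀ (wallCotriangles B (-h) 𝒦)
  rw [finsum_mem_eq_finite_toFinset_sum _ hfin, finsum_mem_eq_finite_toFinset_sum _ hfin']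
  set P := hfin.toFinset with hP
  set Q := hfin'.toFinset with hQ
  let G : (Fin d → ℝ) → ℂ := fun μ =>
    ((∑ i ∈ solutionCotriangle B γ₀ μ, colPairing B h i).sign : ℂ) * omegaResidue B γ₀ τ μ
  have hPs : ∀ μ ∈ P, 0 < ∑ i ∈ solutionCotriangle B γ₀ μ, colPairing B h i := fun μ hμ => by
    obtain ⟨-, -, i, hi, hn, hK, -⟩ := hfin.mem_toFinset.1 hμ
    rwa [(filter_eq_erase_of_facet hi hn.ne' hK).2]
  have hQs : ∀ μ ∈ Q, ∑ i ∈ solutionCotriangle B γ₀ μ, colPairing B h i < 0 := fun μ hμ => by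
    obtain ⟨-, -, i, hi, hn, hK, -⟩ := hfin'.mem_toFinset.1 hμ
    simp only [colPairing_neg, neg_eq_zero] at hn hK
    rw [(filter_eq_erase_of_facet hi (by omega) hK).2]
    omega
  have hdisj : Disjoint P Q := Finset.disjoint_left.2 fun μ h1 h2 =>
    lt_asymm (hPs μ h1) (hQs μ h2)
  have hPG : ∑ μ ∈ P, omegaResidue B γ₀ τ μ = ∑ μ ∈ P, G μ :=
    Finset.sum_congr rfl fun μ hμ => by
      simp only [G]; rw [Int.sign_eq_one_of_pos (hPs μ hμ), Int.cast_one, one_mul]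
  have hQG : ∑ μ ∈ Q, omegaResidue B γ₀ τ μ = -∑ μ ∈ Q, G μ := by
    rw [← Finset.sum_neg_distrib]
    exact Finset.sum_congr rfl fun μ hμ => by
      simp only [G]; rw [Int.sign_eq_neg_one_of_neg (hQs μ hμ)]; simp
  rw [hPG, hQG, ← add_eq_zero_iff_eq_neg, ← Finset.sum_union hdisj]
  have hS : ∀ μ, μ ∈ P ∪ Q ↔ IsSolutionPoint B γ₀ μ ∧ ∃ i ∈ solutionCotriangle B γ₀ μ,
      colPairing B h i ≠ 0 ∧
      (∀ k ∈ (solutionCotriangle B γ₀ μ).erase i, colPairing B h k = 0) ∧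
      (solutionCotriangle B γ₀ μ).erase i ∈ 𝒦 := by
    intro μ
    rw [Finset.mem_union, hP, hQ, hfin.mem_toFinset, hfin'.mem_toFinset]
    simp only [solutionPoints, wallCotriangles, Set.mem_ofPred_eq, colPairing_neg, neg_eq_zero,
      Left.neg_pos_iff]
    constructor
    · rintro (⟨hs, -, i, hi, hn, hK⟩ | ⟨hs, -, i, hi, hn, hK⟩)
      · exact ⟨hs, i, hi, hn.ne', hK⟩
      · exact ⟨hs, i, hi, hn.ne, hK⟩
    · rintro ⟨hs, i, hi, hn, hK⟩
      rcases lt_or_gt_of_ne hn with hn | hn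
      · exact Or.inr ⟨hs, hs.isCotriangleAt.1, i, hi, hn, hK⟩
      · exact Or.inl ⟨hs, hs.isCotriangleAt.1, i, hi, hn, hK⟩
  -- Groups the points by facet and by translate of the one-parameter subgroup; each group cancels
  -- separately.
  let q : (Fin d → ℝ) → Finset (Fin N) × (Fin d → ℂ) := fun μ =>
    ((solutionCotriangle B γ₀ μ).filter (fun k => colPairing B h k = 0),
      torusPart c h (zetaPoint μ))
  rw [← Finset.sum_fiberwise_of_maps_to (g := q) (t := (P ∪ Q).image q)
    fun μ hμ => Finset.mem_image_of_mem q hμ]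
  refine Finset.sum_eq_zero fun y hy => ?_
  obtain ⟨μ₀, hμ₀, rfl⟩ := Finset.mem_image.1 hy
  rw [← sum_signed_residues_fiber_eq_zero hN hB hα hτ hch hS hμ₀]
  refine Finset.sum_congr (Finset.filter_congr fun μ _ => ?_) fun _ _ => rfl
  simp only [q, Prod.mk.injEq]

/-- An integral hyperplane is the kernel of a unimodular integral linear form. -/
theorem exists_primitive_linForm {B : Matrix (Fin d) (Fin N) ℤ} {I : Finset (Fin N)}
    (hI : IsCotriangle B I) {i : Fin N} (hi : i ∈ I) :
    ∃ h c : Fin d → ℤ, ∑ k, h k * c k = 1 ∧ LinearMap.ker (linForm h) =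
      Submodule.span ℝ (realCol B '' ((I.erase i : Finset (Fin N)) : Set (Fin N))) := by
  classical
  set g := I.orderEmbOfFin hI.1 with hg
  have hgr : ∀ j ∈ I, ∃ p, g p = j := fun j hj => by
    have : j ∈ Set.range g := by rw [hg, Finset.range_orderEmbOfFin]; exact hj
    exact this
  obtain ⟨p, hp⟩ := hgr i hi
  -- Zeroing the column of `i` makes the determinant vanish, so some nonzero integral `v` is
  -- orthogonal to the facet. Dividing by the gcd of its entries makes it primitive, and `c` is the
  -- Bézout vector.
  let M : Matrix (Fin d) (Fin d) ℤ := Matrix.of fun k a => if a = p then 0 else B k (g a)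
  obtain ⟨v, hv, hvM⟩ := Matrix.exists_vecMul_eq_zero_iff.2
    (show M.det = 0 from Matrix.det_eq_zero_of_column_eq_zero p fun k => by simp [M])
  obtain ⟨γ, hγ⟩ := (IsPrincipalIdealRing.principal (Ideal.span (Set.range v))).principal
  have hγm : γ ∈ Ideal.span (Set.range v) := by rw [hγ]; exact Submodule.mem_span_singleton_self γ
  obtain ⟨c, hc⟩ := Submodule.mem_span_range_iff_exists_fun ℤ |>.1 hγm
  have hdvd : ∀ k, ∃ e, e * γ = v k := fun k => by
    have : v k ∈ Ideal.span (Set.range v) := Ideal.subset_span ⟨k, rfl⟩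
    rw [hγ] at this
    exact Submodule.mem_span_singleton.1 this
  choose h hh using hdvd
  have hγ0 : γ ≠ 0 := by
    rintro rfl
    exact hv (funext fun k => by simp [← hh k])
  have hch : ∑ k, h k * c k = 1 := by
    refine mul_right_cancel₀ hγ0 ?_
    rw [one_mul, Finset.sum_mul]
    conv_rhs => rw [← hc]
    exact Finset.sum_congr rfl fun k _ => by rw [← hh k, smul_eq_mul]; ring
  have hK : ∀ j ∈ I.erase i, linForm h (realCol B j) = 0 := fun j hj => by
    obtain ⟨a, rfl⟩ := hgr j (Finset.mem_of_mem_erase hj)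
    have hap : a ≠ p := fun h => (Finset.ne_of_mem_erase hj) (by rw [h, hp])
    have h1 := congrFun hvM a
    have h2 : γ * colPairing B h (g a) = 0 := by
      rw [colPairing, Finset.mul_sum, ← Pi.zero_apply (M := fun _ => ℤ) a, ← h1, Matrix.vecMul,
        dotProduct]
      refine Finset.sum_congr rfl fun k _ => ?_
      simp only [M, Matrix.of_apply, if_neg hap, ← hh k]
      ring
    rw [linForm_realCol, (mul_eq_zero.1 h2).resolve_left hγ0, Int.cast_zero]
  refine ⟨h, c, hch, (Submodule.eq_of_le_of_finrank_le (Submodule.span_le.2 ?_) ?_).symm⟩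
  · rintro _ ⟨j, hj, rfl⟩
    exact hK j hj
  · have hne : linForm h ≠ 0 := fun h0 => by
      have h1 := LinearMap.congr_fun h0 (fun k => (c k : ℝ))
      rw [linForm_apply] at h1
      have h2 : ((∑ k, h k * c k : ℤ) : ℝ) = 0 := by push_cast; exact h1
      rw [hch] at h2
      norm_num at h2
    have h1 := Module.Dual.finrank_ker_add_one_of_ne_zero hne
    rw [Module.finrank_fin_fun] at h1
    have h2 := (facet_isFaceOf hI hi).2
    have h3 : Submodule.span ℝ (colCone B (I.erase i) : Set (Fin d → ℝ)) ≤
        Submodule.span ℝ (realCol B '' ((I.erase i : Finset (Fin N)) : Set (Fin N))) := by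
      refine Submodule.span_le.2 fun x hx => ?_
      obtain ⟨c, -, hc, hs⟩ := mem_colCone_iff.1 hx
      exact (mem_span_image_iff _ _ _).2 ⟨c, hc, hs⟩
    have h4 := Submodule.finrank_mono h3
    omega

theorem cotrianglesAtWall_eq {B : Matrix (Fin d) (Fin N) ℤ} {ρ : Fin d → ℝ}
    (hρ : IsConvergenceDirection B ρ) {W : PointedCone ℝ (Fin d → ℝ)}
    (hW : IsCodimOneFace W (chamber B (cotriangulationOf B ρ))) {h : Fin d → ℤ}
    (hker : Submodule.span ℝ (W : Set (Fin d → ℝ)) = LinearMap.ker (linForm h))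
    (hpos : 0 < linForm h ρ) :
    cotrianglesAtWall B (cotriangulationOf B ρ) W =
      wallCotriangles B h {K | W ≤ colCone B K} := by
  ext I
  rw [mem_cotrianglesAtWall_iff hρ hW hker hpos]
  simp only [linForm_realCol, Int.cast_pos, Int.cast_eq_zero]
  rfl

theorem finsum_residues_cotrianglesAtWall_eq (hN : N = r + d) {A : Matrix (Fin r) (Fin N) ℤ}
    {B : Matrix (Fin d) (Fin N) ℤ} (hB : IsGaleDual A B) {γ₀ : Fin N → ℝ}
    (hα : IsTotallyNonresonant A ((A.map (Int.cast : ℤ → ℝ)) *ᵥ γ₀))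
    {ρ ρ' : Fin d → ℝ} (hρ : IsConvergenceDirection B ρ) (hρ' : IsConvergenceDirection B ρ')
    {W : PointedCone ℝ (Fin d → ℝ)}
    (hW : IsCommonWall B (cotriangulationOf B ρ) (cotriangulationOf B ρ') W)
    {τ : Fin d → ℤ} (hτ : (fun k => (τ k : ℝ)) ∈ openZonotope B)
    {I : Finset (Fin N)} (hI : I ∈ cotrianglesAtWall B (cotriangulationOf B ρ) W) :
    ∑ᶠ μ ∈ solutionPoints B γ₀ (cotrianglesAtWall B (cotriangulationOf B ρ) W),
        omegaResidue B γ₀ τ μ =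
      ∑ᶠ μ ∈ solutionPoints B γ₀ (cotrianglesAtWall B (cotriangulationOf B ρ') W),
        omegaResidue B γ₀ τ μ := by
  obtain ⟨i, hi, hspan, -⟩ := exists_facet_of_mem_cotrianglesAtWall hW.1.2 hI
  obtain ⟨h, c, hch, hker⟩ := exists_primitive_linForm hI.1.1 hi
  have hker' := hspan.trans hker.symm
  have hkern : Submodule.span ℝ (W : Set (Fin d → ℝ)) = LinearMap.ker (linForm (-h)) := by
    rw [hker', linForm_neg]
    ext x
    simp
  have hchn : ∑ k, (-h) k * (-c) k = 1 := by simpa using hch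
  have hcard : (I.erase i).card + 1 = d := by rw [Finset.card_erase_add_one hi, hI.1.1.1]
  have hne : ∀ {x}, IsConvergenceDirection B x → linForm h x ≠ 0 := fun {x} hx h0 =>
    hx _ hcard (by rw [← hker]; exact h0)
  have hneg : ∀ {x}, linForm h x < 0 → 0 < linForm (-h) x := fun {x} hx => by
    rw [linForm_neg]; simpa using hx
  -- If ρ and ρ' lie on the same side, the two sets of cotriangles coincide; otherwise they belong
  -- to `h` and `-h`.
  rcases lt_or_gt_of_ne (hne hρ) with h1 | h1 <;> rcases lt_or_gt_of_ne (hne hρ') with h2 | h2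
  · rw [cotrianglesAtWall_eq hρ hW.1 hkern (hneg h1), cotrianglesAtWall_eq hρ' hW.2 hkern (hneg h2)]
  · rw [cotrianglesAtWall_eq hρ hW.1 hkern (hneg h1), cotrianglesAtWall_eq hρ' hW.2 hker' h2,
      finsum_residues_wallCotriangles_eq hN hB hα hτ hch]
  · rw [cotrianglesAtWall_eq hρ hW.1 hker' h1, cotrianglesAtWall_eq hρ' hW.2 hkern (hneg h2),
      finsum_residues_wallCotriangles_eq hN hB hα hτ hch]
  · rw [cotrianglesAtWall_eq hρ hW.1 hker' h1, cotrianglesAtWall_eq hρ' hW.2 hker' h2]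

end AHyp

end

theorem mainTheorem2 {r d N : ℕ} (hN : N = r + d)
    (A : Matrix (Fin r) (Fin N) ℤ) (B : Matrix (Fin d) (Fin N) ℤ)
    (hsum : ∀ l ∈ AHyp.relationLattice A, ∑ i, l i = 0)
    (hB : AHyp.IsGaleDual A B)
    (γ₀ : Fin N → ℝ)
    (hα : AHyp.IsTotallyNonresonant A ((A.map (Int.cast : ℤ → ℝ)) *ᵥ γ₀))
    (T T' : Set (Finset (Fin N)))
    (hT : AHyp.IsCotriangulation B T) (hT' : AHyp.IsCotriangulation B T')
    (W : PointedCone ℝ (Fin d → ℝ)) (hW : AHyp.IsCommonWall B T T' W)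
    (τ : Fin d → ℤ) (hτ : (fun k => (τ k : ℝ)) ∈ AHyp.openZonotope B) :
    (AHyp.solutionPoints B γ₀ (AHyp.cotrianglesAtWall B T W)).Finite ∧
    (AHyp.solutionPoints B γ₀ (AHyp.cotrianglesAtWall B T' W)).Finite ∧
    ∑ᶠ μ ∈ AHyp.solutionPoints B γ₀ (AHyp.cotrianglesAtWall B T W),
        AHyp.omegaResidue B γ₀ τ μ =
      ∑ᶠ ν ∈ AHyp.solutionPoints B γ₀ (AHyp.cotrianglesAtWall B T' W),
        AHyp.omegaResidue B γ₀ τ ν := by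
  refine ⟨AHyp.finite_solutionPoints _ _ _, AHyp.finite_solutionPoints _ _ _, ?_⟩
  obtain ⟨ρ, hρ, rfl⟩ := hT
  obtain ⟨ρ', hρ', rfl⟩ := hT'
  rcases (AHyp.cotrianglesAtWall B (AHyp.cotriangulationOf B ρ) W).eq_empty_or_nonempty
    with h | ⟨I, hI⟩
  · rcases (AHyp.cotrianglesAtWall B (AHyp.cotriangulationOf B ρ') W).eq_empty_or_nonempty
      with h' | ⟨I, hI⟩
    · rw [h, h']
    · exact (AHyp.finsum_residues_cotrianglesAtWall_eq hN hB hα hρ' hρ hW.symm hτ hI).symm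
  · exact AHyp.finsum_residues_cotrianglesAtWall_eq hN hB hα hρ hρ' hW hτ hI
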